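/- Let $(R,\mathfrak m)$ be a regular local ring of characteristic $p>0$ whose Frobenius endomorphism is finite, and let $0\neq f\in R$. For a Noetherian local ring $(S,\mathfrak n)$ of characteristic $p$ and dimension $d$ with a system of parameters $x_1,\dots,x_d$, we use the top local cohomology module $H^d_{\mathfrak n}(S)=S_{x_1\cdots x_d}/\sum_i S_{x_1\cdots\widehat{x_i}\cdots x_d}$ together with the additive map on it induced by the Frobenius of $S$, namely $[a/(x_1\cdots x_d)^t]\mapsto[a^p/(x_1\cdots x_d)^{tp}]$. Let $E_R=H^{\dim R}_{\mathfrak m}(R)$ (this is an injective hull of the residue field of $R$), with induced map $F$. If $f\in\mathfrak m$, let $S=R/(f)$, with maximal ideal $\mathfrak n$, and let $E_S=H^{\dim S}_{\mathfrak n}(S)$ (an injective hull of the residue field of $S$), with induced map $\Theta$. For an additive map $\varphi\colon M\to M$ with $\varphi(az)=a^p\varphi(z)$, put $N_i=\{z\in M\mid\varphi^i(z)=0\}$; the HSL number of $(M,\varphi)$ is the smallest integer $\ell\ge 1$ such that $N_\ell=N_{\ell+j}$ for all $j\ge1$. For an ideal $J$ of $R$ let $J^{[p^e]}=(h^{p^e}\mid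 h\in J)$, and for an ideal $\mathfrak b$ let $\mathfrak b^{[1/p^e]}$ be the smallest ideal $J$ with $\mathfrak b\subseteq J^{[p^e]}$. For real $\lambda\ge0$ the test ideal $\tau(f^\lambda)$ is the common value of the ideals $(f^{\lceil\lambda p^e\rceil})^{[1/p^e]}$ for $e\gg0$ (they form an ascending chain). A real number $\lambda>0$ is an $F$-jumping number of $f$ if $\tau(f^\lambda)\ne\tau(f^\mu)$ for every $\mu$ with $0\le\mu<\lambda$. Then the HSL number of $(E_R,f^{p-1}F)$ exists and is the smallest integer $\ell\ge1$ such that $$\tau\bigl(f^{1-1/p^{\ell}}\bigr)=\tau\bigl(f^{1-1/p^{\ell+i}}\bigr)\quad\text{for all } i\ge1 .$$ If $f\in\mathfrak m$, then the HSL number of $(E_{R/(f)},\Theta)$ exists and is the same number $\ell$. Moreover, for every integer $\ell\ge1$ the displayed condition holds if and only if $f$ has no $F$-jumping number in the open interval $(1-1/p^\ell,1)$; hence the HSL number is also the smallest $\ell\ge1$ with this property. -/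

import Mathlib

open IsLocalRing

noncomputable section

/-! ### `p`-linear structures and Hartshorne–Speiser–Lyubeznik numbers

A `p`-linear structure on an `S`-module `M` (an additive map `φ` with `φ (a z) = a ^ p φ z`) is a
map `φ : M →ₛₗ[frobenius S p] M` that is semilinear with respect to the Frobenius of `S`. -/

/-- The set `N_i = {z ∈ M ∣ φ^i z = 0}` for a `p`-linear structure `φ` on `M`. -/
def nilKernel {S : Type*} [CommRing S] {p : ℕ} [ExpChar S p] {M : Type*} [AddCommGroup M]
    [Module S M] (φ : M →ₛₗ[frobenius S p] M) (i : ℕ) : Set M :=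
  {z | φ^[i] z = 0}

/-- `ℓ` is the HSL number of `(M, φ)`: the smallest positive integer `ℓ` such that
`N_ℓ = N_{ℓ + j}` for all `j ≥ 1`. -/
def IsHSLNumber {S : Type*} [CommRing S] {p : ℕ} [ExpChar S p] {M : Type*} [AddCommGroup M]
    [Module S M] (φ : M →ₛₗ[frobenius S p] M) (ℓ : ℕ) : Prop :=
  IsLeast {l : ℕ | 1 ≤ l ∧ ∀ j : ℕ, 1 ≤ j → nilKernel φ l = nilKernel φ (l + j)} ℓ

/-! ### Top local cohomology and its Frobenius action -/

/-- `x₁, …, x_d` is a system of parameters of the local ring `S`: `d = dim S`, and the `x_i`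
generate an ideal whose radical is the maximal ideal. -/
structure IsSystemOfParameters {S : Type*} [CommRing S] [IsLocalRing S] {d : ℕ}
    (x : Fin d → S) : Prop where
  ringKrullDim_eq : ringKrullDim S = d
  radical_eq : (Ideal.span (Set.range x)).radical = maximalIdeal S

/-- The submodule `∑ i, S_{x₁ ⋯ x̂_i ⋯ x_d}` of `S_{x₁ ⋯ x_d}`, where `x̂_i` means that `x_i` is
omitted: the sum of the images of the canonical maps `S_{x₁ ⋯ x̂_i ⋯ x_d} → S_{x₁ ⋯ x_d}`.  The
image of the `i`-th map consists of the fractions `a / (x₁ ⋯ x̂_i ⋯ x_d) ^ t`, that is (the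
denominator being a unit in `S_{x₁ ⋯ x_d}`) of the `z` with
`z * (x₁ ⋯ x̂_i ⋯ x_d) ^ t = a` for some `a ∈ S` and some `t`. -/
def cechBoundary {S : Type*} [CommRing S] {d : ℕ} (x : Fin d → S) :
    Submodule S (Localization.Away (∏ i, x i)) :=
  Submodule.span S {z | ∃ (i : Fin d) (t : ℕ) (a : S),
    z * algebraMap S (Localization.Away (∏ i, x i)) ((∏ j ∈ Finset.univ.erase i, x j) ^ t) =
      algebraMap S (Localization.Away (∏ i, x i)) a}

/-- The top Čech cohomology `S_{x₁ ⋯ x_d} / ∑ i, S_{x₁ ⋯ x̂_i ⋯ x_d}`.  When `x` is a system of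
parameters of the local ring `(S, 𝔫)`, this is the top local cohomology module `H^d_𝔫(S)`.  If `S`
is regular, or a regular local ring modulo a nonzero element of its maximal ideal, it is an
injective hull `E_S` of the residue field of `S`. -/
abbrev TopLocalCohomology {S : Type*} [CommRing S] {d : ℕ} (x : Fin d → S) : Type _ :=
  Localization.Away (∏ i, x i) ⧸ cechBoundary x

theorem powers_le_comap_frobenius {S : Type*} [CommRing S] (p : ℕ) [ExpChar S p] (g : S) :
    Submonoid.powers g ≤ (Submonoid.powers g).comap (frobenius S p) := by
  rintro _ ⟨t, rfl⟩
  exact ⟨t * p, by simp [frobenius_def, pow_mul]⟩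

/-- The map `S_g → S_g`, `a / g ^ t ↦ a ^ p / g ^ (t * p)`, induced by the Frobenius of `S`. -/
def frobeniusAway {S : Type*} [CommRing S] (p : ℕ) [ExpChar S p] (g : S) :
    Localization.Away g →ₛₗ[frobenius S p] Localization.Away g where
  toFun := IsLocalization.map (M := Submonoid.powers g) (T := Submonoid.powers g)
    (Localization.Away g) (frobenius S p) (powers_le_comap_frobenius p g)
  map_add' := map_add _
  map_smul' a z := by
    rw [Algebra.smul_def, Algebra.smul_def, map_mul, IsLocalization.map_eq]

theorem frobeniusAway_mul {S : Type*} [CommRing S] (p : ℕ) [ExpChar S p] (g : S)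
    (y z : Localization.Away g) :
    frobeniusAway p g (y * z) = frobeniusAway p g y * frobeniusAway p g z :=
  map_mul (IsLocalization.map (M := Submonoid.powers g) (T := Submonoid.powers g)
    (Localization.Away g) (frobenius S p) (powers_le_comap_frobenius p g)) y z

theorem frobeniusAway_algebraMap {S : Type*} [CommRing S] (p : ℕ) [ExpChar S p] (g a : S) :
    frobeniusAway p g (algebraMap S (Localization.Away g) a) =
      algebraMap S (Localization.Away g) (a ^ p) :=
  IsLocalization.map_eq (M := Submonoid.powers g) (T := Submonoid.powers g)
    (powers_le_comap_frobenius p g) a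

theorem cechBoundary_le_comap {S : Type*} [CommRing S] (p : ℕ) [ExpChar S p] {d : ℕ}
    (x : Fin d → S) :
    cechBoundary x ≤ (cechBoundary x).comap (frobeniusAway p (∏ i, x i)) := by
  refine Submodule.span_le.2 ?_
  rintro z ⟨i, t, a, h⟩
  refine Submodule.subset_span ⟨i, t * p, a ^ p, ?_⟩
  rw [pow_mul, ← frobeniusAway_algebraMap, ← frobeniusAway_mul, h, frobeniusAway_algebraMap]

/-- The natural `p`-linear structure on the top local cohomology module that the Frobenius of `S`
induces by functoriality: `[a / (x₁ ⋯ x_d) ^ t] ↦ [a ^ p / (x₁ ⋯ x_d) ^ (t * p)]`. -/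
def frobeniusAction {S : Type*} [CommRing S] (p : ℕ) [ExpChar S p] {d : ℕ} (x : Fin d → S) :
    TopLocalCohomology x →ₛₗ[frobenius S p] TopLocalCohomology x :=
  (cechBoundary x).mapQ (cechBoundary x) (frobeniusAway p (∏ i, x i)) (cechBoundary_le_comap p x)

/-! ### The hypersurface ring `R / (f)` -/

theorem isLocalRing_quotient_span {R : Type*} [CommRing R] [IsLocalRing R] {f : R}
    (hf : f ∈ maximalIdeal R) : IsLocalRing (R ⧸ Ideal.span {f}) :=
  have : Nontrivial (R ⧸ Ideal.span {f}) := Ideal.Quotient.nontrivial_iff.2 fun h =>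
    hf (Ideal.span_singleton_eq_top.1 h)
  IsLocalRing.of_surjective' _ Ideal.Quotient.mk_surjective

theorem charP_quotient_span {R : Type*} [CommRing R] [IsLocalRing R] (p : ℕ) [Fact p.Prime]
    [CharP R p] {f : R} (hf : f ∈ maximalIdeal R) : CharP (R ⧸ Ideal.span {f}) p :=
  have : Nontrivial (R ⧸ Ideal.span {f}) := Ideal.Quotient.nontrivial_iff.2 fun h =>
    hf (Ideal.span_singleton_eq_top.1 h)
  (CharP.charP_iff_prime_eq_zero Fact.out).2 (by
    rw [← map_natCast (Ideal.Quotient.mk (Ideal.span {f})), CharP.cast_eq_zero, map_zero])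

/-! ### Test ideals and `F`-jumping numbers -/

/-- `R` is `F`-finite: its Frobenius endomorphism is a finite ring homomorphism. -/
def IsFFinite (R : Type*) [CommRing R] (p : ℕ) [ExpChar R p] : Prop :=
  (frobenius R p).Finite

/-- The ideal `J^{[p^e]}`, generated by the `h ^ (p ^ e)` with `h ∈ J`. -/
def frobPower {R : Type*} [CommRing R] (p : ℕ) (J : Ideal R) (e : ℕ) : Ideal R :=
  Ideal.span {y | ∃ h ∈ J, y = h ^ p ^ e}

/-- The ideal `𝔟^{[1/p^e]}`: the smallest ideal `J` with `𝔟 ⊆ J^{[p^e]}`, written as the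
intersection of all these `J`. -/
def frobRoot {R : Type*} [CommRing R] (p : ℕ) (𝔟 : Ideal R) (e : ℕ) : Ideal R :=
  sInf {J : Ideal R | 𝔟 ≤ frobPower p J e}

/-- The test ideal `τ(𝔞^lam)`.  The ideals `(𝔞^⌈lam p^e⌉)^{[1/p^e]}`, `e ≥ 1`, form an ascending
chain; their common value for large `e` is the union (supremum) of the chain. -/
def testIdeal {R : Type*} [CommRing R] (p : ℕ) (𝔞 : Ideal R) (lam : ℝ) : Ideal R :=
  ⨆ e : ℕ, ⨆ _ : 1 ≤ e, frobRoot p (𝔞 ^ ⌈lam * (p : ℝ) ^ e⌉₊) e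

/-- `lam` is an `F`-jumping number of `𝔞`: it is positive and `τ(𝔞^lam) ≠ τ(𝔞^μ)` for every
`μ` with `0 ≤ μ < lam`. -/
def IsFJumpingNumber {R : Type*} [CommRing R] (p : ℕ) (𝔞 : Ideal R) (lam : ℝ) : Prop :=
  0 < lam ∧ ∀ μ : ℝ, 0 ≤ μ → μ < lam → testIdeal p 𝔞 lam ≠ testIdeal p 𝔞 μ

end

noncomputable section

/-! ### Frobenius powers and Frobenius roots -/

section FrobeniusPowers

set_option linter.unusedSectionVars false

variable {R : Type*} [CommRing R] (p : ℕ) [ExpChar R p]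

/-! Put `I_e = (f^(p^e - 1))^{[1/p^e]}` (`hslIdeal`). Each of the numbers being compared records
where the single descending chain `I_0 ⊇ I_1 ⊇ …` becomes constant.

Kernels of Frobenius. By Kunz, `R` is free over itself via each Frobenius iterate
(`IsFFinite.hasFrobeniusCoordinates`). Hence Frobenius roots are adjoint to Frobenius powers, and
with `q = p^e`, `f^(q-1) a^q ∈ Q^{[q]}` means `I_e a ⊆ Q` (`mul_pow_mem_frobPower_iff`). Parameters
form a regular sequence (`IsParameterList.isWeaklyRegular`), so `a / (∏ x_i)^t` vanishes in top
cohomology exactly when `a ∈ (x_i^t)` (`mem_cechBoundary_iff`). Thus the `e`-th kernel on `E_R` is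
the annihilator of `I_e`. On `E_{R/(f)}` it is too, because multiplication by `f^(q-1)` lifts the
membership from `R/(f)` to `R` (`pow_mem_span_sup_powIdeal_iff`). These annihilators determine
`I_e`: `R` is Gorenstein (`IsParameterList.hasSimpleSocle`), and double-colon duality in Artinian
quotients separates ideals (`IsParameterList.exists_separating`).

Stabilization. The chain is the orbit of `R` under `J ↦ (f^(p-1) J)^{[1/p]}`, so one equality of
neighbours propagates. One exists (`exists_hslIdeal_eq_succ`): the colons `I_{n+1} : I_n` increase
to an ideal `D`, and if `D` were proper, the chain would stop after localizing at a minimal prime of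
`D`, which contradicts the choice of that prime.

Test ideals. `I_e = τ(f^(1 - 1/p^e))` for `e ≥ 1` (`testIdeal_one_sub`), and `τ(f^λ)` is decreasing
and right continuous in `λ`, so every drop takes place at a jumping number
(`exists_isFJumpingNumber`). -/

theorem frobPower_eq_map (J : Ideal R) (e : ℕ) :
    frobPower p J e = J.map (iterateFrobenius R p e) := by
  rw [frobPower, Ideal.map]
  congr 1
  ext y
  simp [iterateFrobenius_def, eq_comm]

theorem pow_mem_frobPower {J : Ideal R} {h : R} (hh : h ∈ J) (e : ℕ) :
    h ^ p ^ e ∈ frobPower p J e :=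
  Ideal.subset_span ⟨h, hh, rfl⟩

theorem frobPower_le_self (J : Ideal R) (e : ℕ) : frobPower p J e ≤ J := by
  refine Ideal.span_le.2 ?_
  rintro _ ⟨h, hh, rfl⟩
  exact J.pow_mem_of_mem hh _ (pow_pos (expChar_pos R p) e)

theorem frobPower_le_pow (J : Ideal R) (e : ℕ) : frobPower p J e ≤ J ^ p ^ e := by
  refine Ideal.span_le.2 ?_
  rintro _ ⟨h, hh, rfl⟩
  exact Ideal.pow_mem_pow hh _

theorem frobPower_frobPower (J : Ideal R) (e k : ℕ) :
    frobPower p (frobPower p J k) e = frobPower p J (e + k) := by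
  simp only [frobPower_eq_map, Ideal.map_map, iterateFrobenius_add]

theorem frobPower_span (s : Set R) (e : ℕ) :
    frobPower p (Ideal.span s) e = Ideal.span ((fun a ↦ a ^ p ^ e) '' s) := by
  rw [frobPower_eq_map, Ideal.map_span]
  rfl

theorem frobPower_span_singleton (a : R) (e : ℕ) :
    frobPower p (Ideal.span {a}) e = Ideal.span {a ^ p ^ e} := by
  rw [frobPower_span, Set.image_singleton]

/-- Coordinate functions of `R` as a free module over itself via the `e`-th iterate of the
Frobenius: they detect Frobenius powers of ideals. -/
structure FrobeniusCoordinates (R : Type*) [CommRing R] (p e : ℕ) where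
  /-- The index set of the basis. -/
  ι : Type
  /-- The coordinate functions. -/
  coord : ι → R → R
  coord_mul : ∀ i a r, coord i (a ^ p ^ e * r) = a * coord i r
  mem_frobPower_iff : ∀ (J : Ideal R) r, r ∈ frobPower p J e ↔ ∀ i, coord i r ∈ J

/-- For all `e`, the ring is free over itself via the `e`-th iterate of the Frobenius. -/
def HasFrobeniusCoordinates (R : Type*) [CommRing R] (p : ℕ) : Prop :=
  ∀ e, Nonempty (FrobeniusCoordinates R p e)

variable {p}

/-- Membership in `J^{[p^e]}` is a condition on coordinates, so Frobenius powers commute with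
arbitrary intersections and the infimum defining `frobRoot` is attained. -/
theorem le_frobPower_iff (H : HasFrobeniusCoordinates R p) {𝔟 J : Ideal R} {e : ℕ} :
    𝔟 ≤ frobPower p J e ↔ frobRoot p 𝔟 e ≤ J := by
  obtain ⟨c⟩ := H e
  refine ⟨fun h ↦ sInf_le h, fun h r hr ↦ (c.mem_frobPower_iff J r).2 fun i ↦ h ?_⟩
  refine (Submodule.mem_sInf).2 fun K hK ↦ ?_
  exact (c.mem_frobPower_iff K r).1 (hK hr) i

theorem le_frobPower_frobRoot (H : HasFrobeniusCoordinates R p) (𝔟 : Ideal R) (e : ℕ) :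
    𝔟 ≤ frobPower p (frobRoot p 𝔟 e) e :=
  (le_frobPower_iff H).2 le_rfl

theorem frobRoot_mono {𝔞 𝔟 : Ideal R} (h : 𝔞 ≤ 𝔟) (e : ℕ) : frobRoot p 𝔞 e ≤ frobRoot p 𝔟 e :=
  sInf_le_sInf fun _ hJ ↦ h.trans hJ

theorem frobRoot_frobPower_mul (H : HasFrobeniusCoordinates R p) (𝔞 𝔟 : Ideal R) (e : ℕ) :
    frobRoot p (frobPower p 𝔞 e * 𝔟) e = 𝔞 * frobRoot p 𝔟 e := by
  refine le_antisymm ?_ ?_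
  · rw [← le_frobPower_iff H]
    refine (Ideal.mul_mono_right (le_frobPower_frobRoot H 𝔟 e)).trans_eq ?_
    simp only [frobPower_eq_map, Ideal.map_mul]
  · obtain ⟨c⟩ := H e
    refine Ideal.mul_le.2 fun a ha b hb ↦ ?_
    -- By adjunction it is enough to place the coordinates of elements of `𝔟` in this colon;
    -- semilinearity turns `a` times a coordinate of `r` into a coordinate of `a ^ p ^ e * r`.
    suffices frobRoot p 𝔟 e ≤ Submodule.colon (frobRoot p (frobPower p 𝔞 e * 𝔟) e) {a} by
      have := Submodule.mem_colon_singleton.1 (this hb)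
      rwa [smul_eq_mul, mul_comm _ a] at this
    rw [← le_frobPower_iff H]
    intro r hr
    refine (c.mem_frobPower_iff _ _).2 fun i ↦ ?_
    rw [Submodule.mem_colon_singleton, smul_eq_mul, mul_comm _ a, ← c.coord_mul]
    refine (c.mem_frobPower_iff _ _).1 (le_frobPower_frobRoot H _ e ?_) i
    exact Ideal.mul_mem_mul (pow_mem_frobPower p ha e) hr

theorem frobRoot_top (e : ℕ) : frobRoot p (⊤ : Ideal R) e = ⊤ :=
  top_le_iff.1 (le_sInf fun J hJ ↦ hJ.trans (frobPower_le_self p J e))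

theorem frobRoot_frobPower (H : HasFrobeniusCoordinates R p) (𝔞 : Ideal R) (e : ℕ) :
    frobRoot p (frobPower p 𝔞 e) e = 𝔞 := by
  rw [← Ideal.mul_top (frobPower p 𝔞 e), frobRoot_frobPower_mul H, frobRoot_top, Ideal.mul_top]

theorem frobRoot_zero (𝔟 : Ideal R) : frobRoot p 𝔟 0 = 𝔟 := by
  have (J : Ideal R) : frobPower p J 0 = J := by simp [frobPower]
  refine le_antisymm (sInf_le (this 𝔟).ge) (le_sInf fun J hJ ↦ ?_)
  rwa [Set.mem_ofPred_eq, this] at hJ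

theorem frobRoot_frobRoot (H : HasFrobeniusCoordinates R p) (𝔟 : Ideal R) (e k : ℕ) :
    frobRoot p (frobRoot p 𝔟 e) k = frobRoot p 𝔟 (e + k) := by
  refine eq_of_forall_ge_iff fun J ↦ ?_
  rw [← le_frobPower_iff H, ← le_frobPower_iff H, ← le_frobPower_iff H, frobPower_frobPower]

/-- The bridge from Frobenius to duality: the condition on `a ^ p ^ e` becomes annihilation of `a`
modulo `Q` by an ideal depending only on `r` and `e`. -/
theorem mul_pow_mem_frobPower_iff (H : HasFrobeniusCoordinates R p) {r a : R} {Q : Ideal R}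
    {e : ℕ} : r * a ^ p ^ e ∈ frobPower p Q e ↔
      ∀ c ∈ frobRoot p (Ideal.span {r}) e, c * a ∈ Q := by
  rw [← Ideal.span_singleton_le_iff_mem, ← Ideal.span_singleton_mul_span_singleton, mul_comm,
    ← frobPower_span_singleton, le_frobPower_iff H, frobRoot_frobPower_mul H,
    Ideal.span_singleton_mul_le_iff]
  simp only [mul_comm]

/-- The ideals `(f ^ (p ^ e - 1))^{[1/p^e]}`. -/
def hslIdeal (p : ℕ) (f : R) (e : ℕ) : Ideal R :=
  frobRoot p (Ideal.span {f ^ (p ^ e - 1)}) e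

/-- From `p^(e+1) - 1 = p^e (p - 1) + (p^e - 1)`. The chain is generated by iterating one monotone
operator, which makes it descending and makes the first equality permanent. -/
theorem hslIdeal_succ (H : HasFrobeniusCoordinates R p) (f : R) (e : ℕ) :
    hslIdeal p f (e + 1) = frobRoot p (Ideal.span {f ^ (p - 1)} * hslIdeal p f e) 1 := by
  rw [hslIdeal, ← frobRoot_frobRoot H, hslIdeal, ← frobRoot_frobPower_mul H,
    frobPower_span_singleton, Ideal.span_singleton_mul_span_singleton, ← pow_mul, ← pow_add]
  congr 5
  have hp := expChar_pos R p
  have := Nat.one_le_pow e p hp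
  rw [pow_succ, Nat.sub_mul, one_mul, mul_comm p]
  have : p ^ e ≤ p ^ e * p := Nat.le_mul_of_pos_right _ hp
  omega

/-- Used for `R / (f)`, where duality separates only ideals containing `f`. -/
theorem mem_hslIdeal (H : HasFrobeniusCoordinates R p) (f : R) (e : ℕ) : f ∈ hslIdeal p f e := by
  rw [← Ideal.span_singleton_le_iff_mem, hslIdeal, ← frobRoot_frobPower H (Ideal.span {f}) e,
    frobPower_span_singleton]
  refine frobRoot_mono ?_ e
  rw [Ideal.span_singleton_le_span_singleton]
  exact pow_dvd_pow f (Nat.sub_le _ _)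

theorem hslIdeal_zero (f : R) : hslIdeal p f 0 = ⊤ := by
  simp [hslIdeal, frobRoot_zero]

theorem hslIdeal_succ_le (H : HasFrobeniusCoordinates R p) (f : R) (e : ℕ) :
    hslIdeal p f (e + 1) ≤ hslIdeal p f e := by
  induction e with
  | zero => rw [hslIdeal_zero]; exact le_top
  | succ e ih =>
    rw [hslIdeal_succ H f (e + 1), hslIdeal_succ H f e]
    exact frobRoot_mono (Ideal.mul_mono_right (by rwa [← hslIdeal_succ H f e])) 1

theorem hslIdeal_antitone (H : HasFrobeniusCoordinates R p) (f : R) :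
    Antitone (hslIdeal p f) :=
  antitone_nat_of_succ_le (hslIdeal_succ_le H f)

theorem hslIdeal_stable (H : HasFrobeniusCoordinates R p) (f : R) {e : ℕ}
    (h : hslIdeal p f e = hslIdeal p f (e + 1)) (i : ℕ) :
    hslIdeal p f e = hslIdeal p f (e + i) := by
  induction i with
  | zero => rfl
  | succ i ih =>
    rw [← add_assoc, hslIdeal_succ H, ← ih, ← hslIdeal_succ H, ← h]

/-- Multiplication by an ideal passes through the Cartier operator as its Frobenius power. -/
theorem mul_hslIdeal_succ (H : HasFrobeniusCoordinates R p) (f : R) (J : Ideal R) (e : ℕ) :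
    J * hslIdeal p f (e + 1) =
      frobRoot p (Ideal.span {f ^ (p - 1)} * (frobPower p J 1 * hslIdeal p f e)) 1 := by
  rw [hslIdeal_succ H, ← frobRoot_frobPower_mul H, mul_left_comm]

end FrobeniusPowers

/-! ### Stabilization of the chain of images of a Cartier operator -/

theorem isArtinianRing_quotient_of_radical_eq {A : Type*} [CommRing A] [IsLocalRing A]
    [IsNoetherianRing A] {K : Ideal A} (hK : K.radical = maximalIdeal A) :
    IsArtinianRing (A ⧸ K) := by
  have hne : K ≠ ⊤ := by
    rintro rfl
    rw [Ideal.radical_top] at hK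
    exact (maximalIdeal.isMaximal A).ne_top hK.symm
  have : Nontrivial (A ⧸ K) := Ideal.Quotient.nontrivial_iff.2 hne
  have : IsLocalRing (A ⧸ K) := IsLocalRing.of_surjective' _ Ideal.Quotient.mk_surjective
  obtain ⟨n, hn⟩ := Ideal.exists_pow_le_of_le_radical_of_fg hK.ge
    (IsNoetherian.noetherian (maximalIdeal A))
  rw [isArtinianRing_iff_isNilpotent_maximalIdeal]
  refine ⟨n, ?_⟩
  rw [← IsLocalRing.map_maximalIdeal_of_surjective _ (Ideal.Quotient.mk_surjective (I := K)),
    ← Ideal.map_pow, Ideal.zero_eq_bot, eq_bot_iff, Ideal.map_le_iff_le_comap]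
  intro x hx
  simpa using Ideal.Quotient.eq_zero_iff_mem.2 (hn hx)

/-- All `J n` lie between `K * J 0` and `J 0`, so they are pulled back from submodules of `J 0 / K J
0`, a finite module over an Artinian ring. -/
theorem exists_eq_succ_of_isArtinianRing_quotient {A : Type*} [CommRing A] [IsNoetherianRing A]
    {K : Ideal A} [IsArtinianRing (A ⧸ K)] {J : ℕ → Ideal A} (hJ : Antitone J)
    (h : ∀ n, K * J 0 ≤ J n) : ∃ n, J n = J (n + 1) := by
  let M := J 0 ⧸ (K • ⊤ : Submodule A (J 0))
  have : Module.Finite (A ⧸ K) M := Module.Finite.of_restrictScalars_finite A _ _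
  have : IsArtinian (A ⧸ K) M := inferInstance
  have : IsArtinian A M :=
    isArtinian_of_surjective_algebraMap (R := A ⧸ K) Ideal.Quotient.mk_surjective
  let g : ℕ → Submodule A M := fun n ↦ (Submodule.comap (J 0).subtype (J n)).map (Submodule.mkQ _)
  have hg : Antitone g := fun m n hmn ↦ Submodule.map_mono (Submodule.comap_mono (hJ hmn))
  obtain ⟨n, hn⟩ := IsArtinian.monotone_stabilizes ⟨fun n ↦ OrderDual.toDual (g n), hg⟩
  refine ⟨n, ?_⟩
  have hn' : g n = g (n + 1) := hn (n + 1) n.le_succ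
  have key (k : ℕ) : ((g k).comap (Submodule.mkQ _)).map (J 0).subtype = J k := by
    rw [Submodule.comap_map_mkQ, Submodule.map_sup, Submodule.map_smul'', Submodule.map_subtype_top,
      Submodule.map_comap_subtype, smul_eq_mul, inf_eq_right.2 (hJ k.zero_le), sup_eq_right]
    exact h k
  rw [← key n, hn', key]

/-- Each of finitely many generators of `I` needs a denominator outside `P`; a prime containing the
intersection of their colons would contain one of them. -/
theorem not_colon_le_of_map_eq {A : Type*} [CommRing A] [IsNoetherianRing A] (P : Ideal A)
    [P.IsPrime] {I J : Ideal A} (h : I.map (algebraMap A (Localization.AtPrime P)) ≤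
      J.map (algebraMap A (Localization.AtPrime P))) : ¬ J.colon (I : Set A) ≤ P := by
  obtain ⟨s, hs⟩ := IsNoetherian.noetherian I
  have : J.colon (I : Set A) = s.inf fun x ↦ J.colon {x} := by
    rw [← hs, Submodule.colon_span]
    ext r
    simp [Submodule.mem_colon, Submodule.mem_finsetInf]
  rw [this, Ideal.IsPrime.inf_le' ‹_›]
  rintro ⟨x, hx, hxP⟩
  have hxI : x ∈ I := hs ▸ Submodule.subset_span hx
  obtain ⟨m, hm, hmx⟩ := (IsLocalization.algebraMap_mem_map_algebraMap_iff P.primeCompl _ J x).1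
    (h (Ideal.mem_map_of_mem _ hxI))
  exact hm (hxP (Submodule.mem_colon_singleton.2 hmx))

theorem colon_eq_top_of_forall_sq_mul_mem {A : Type*} [CommRing A] [IsNoetherianRing A]
    {I : ℕ → Ideal A} (hI : Antitone I) {D : Ideal A}
    (hD : ∀ n, (I (n + 1)).colon (I n : Set A) ≤ D)
    (hsq : ∀ n, ∀ x ∈ D, ∀ a ∈ I 0, x ^ 2 * a ∈ I n) : D = ⊤ := by
  by_contra hne
  obtain ⟨P, hP⟩ := Ideal.nonempty_minimalPrimes hne
  have : P.IsPrime := hP.1.1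
  let B := Localization.AtPrime P
  -- The squares from `D` generate an ideal with the radical of `D`. It multiplies `I 0` into every
  -- `I n`, and at `P` it becomes primary to the maximal ideal, so the local chain has an equality.
  let K : Ideal A := Ideal.span ((fun x ↦ x ^ 2) '' (D : Set A))
  have hKD : K.radical = D.radical := by
    refine le_antisymm (Ideal.radical_mono (Ideal.span_le.2 ?_)) (Ideal.radical_le_radical_iff.2 ?_)
    · rintro _ ⟨x, hx, rfl⟩
      exact D.pow_mem_of_mem hx 2 two_pos
    · exact fun x hx ↦ ⟨2, Ideal.subset_span ⟨x, hx, rfl⟩⟩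
  have hPK : P ∈ K.minimalPrimes := by
    rwa [← Ideal.radical_minimalPrimes, hKD, Ideal.radical_minimalPrimes]
  have hrad : (K.map (algebraMap A B)).radical = maximalIdeal B := by
    rw [IsLocalization.AtPrime.radical_map_of_mem_minimalPrimes B P K hPK,
      IsLocalization.AtPrime.map_eq_maximalIdeal P B]
  have : IsNoetherianRing B := IsLocalization.isNoetherianRing P.primeCompl B inferInstance
  have := isArtinianRing_quotient_of_radical_eq hrad
  obtain ⟨n, hn⟩ := exists_eq_succ_of_isArtinianRing_quotient
    (K := K.map (algebraMap A B)) (J := fun n ↦ (I n).map (algebraMap A B))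
    (fun m n hmn ↦ Ideal.map_mono (hI hmn)) (fun n ↦ by
      rw [← Ideal.map_mul]
      refine Ideal.map_mono (Ideal.mul_le.2 fun r hr a ha ↦ ?_)
      have : K ≤ (I n).colon {a} := by
        refine Ideal.span_le.2 ?_
        rintro _ ⟨x, hx, rfl⟩
        exact Submodule.mem_colon_singleton.2 (hsq n x hx a ha)
      exact Submodule.mem_colon_singleton.1 (this hr))
  exact not_colon_le_of_map_eq P hn.le ((hD n).trans hP.1.2)

theorem exists_hslIdeal_eq_succ {R : Type*} [CommRing R] [IsNoetherianRing R] {p : ℕ}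
    [Fact p.Prime] [CharP R p] (H : HasFrobeniusCoordinates R p) (f : R) :
    ∃ e, hslIdeal p f e = hslIdeal p f (e + 1) := by
  have hp : 2 ≤ p := (Fact.out : p.Prime).two_le
  let D : ℕ → Ideal R := fun n ↦ (hslIdeal p f (n + 1)).colon (hslIdeal p f n : Set R)
  have mem_D {n : ℕ} {J : Ideal R} : J ≤ D n ↔ J * hslIdeal p f n ≤ hslIdeal p f (n + 1) := by
    rw [Ideal.mul_le]
    exact forall₂_congr fun _ _ ↦ Submodule.mem_colon
  have hD : Monotone D := by
    refine monotone_nat_of_le_succ fun n ↦ ?_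
    rw [mem_D, mul_hslIdeal_succ H, hslIdeal_succ H f (n + 1)]
    exact frobRoot_mono (Ideal.mul_mono_right
      ((Ideal.mul_mono_left (frobPower_le_self p _ 1)).trans (mem_D.1 le_rfl))) 1
  obtain ⟨n₀, hn₀⟩ := monotone_stabilizes_iff_noetherian.2 (inferInstance : IsNoetherianRing R)
    ⟨D, hD⟩
  replace hn₀ (n : ℕ) : D (n₀ + n) = D n₀ := (hn₀ (n₀ + n) (Nat.le_add_right _ _)).symm
  refine ⟨n₀, le_antisymm ?_ (hslIdeal_succ_le H f n₀)⟩
  suffices hT : D n₀ = ⊤ by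
    have := mem_D.1 hT.ge
    rwa [Ideal.top_mul] at this
  refine colon_eq_top_of_forall_sq_mul_mem (I := fun n ↦ hslIdeal p f (n₀ + n))
    (fun m n hmn ↦ hslIdeal_antitone H f (Nat.add_le_add_left hmn _)) (fun n ↦ (hn₀ n).le) ?_
  intro n x hx a ha
  suffices hs : Ideal.span {x ^ 2} * hslIdeal p f n₀ ≤ hslIdeal p f (n₀ + n) from
    hs (Ideal.mul_mem_mul (Ideal.mem_span_singleton_self _) ha)
  have hx1 : Ideal.span {x} * hslIdeal p f n₀ ≤ hslIdeal p f (n₀ + 1) :=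
    mem_D.1 ((Ideal.span_singleton_le_iff_mem _).2 hx)
  induction n with
  | zero => exact Ideal.mul_le_right (I := Ideal.span {x ^ 2})
  | succ n ih =>
    calc Ideal.span {x ^ 2} * hslIdeal p f n₀
        = Ideal.span {x} * (Ideal.span {x} * hslIdeal p f n₀) := by
          rw [← mul_assoc, Ideal.span_singleton_mul_span_singleton, pow_two]
      _ ≤ Ideal.span {x} * hslIdeal p f (n₀ + 1) := Ideal.mul_mono_right hx1
      _ = frobRoot p (Ideal.span {f ^ (p - 1)} * (Ideal.span {x ^ p} * hslIdeal p f n₀)) 1 := by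
          rw [mul_hslIdeal_succ H, frobPower_span_singleton, pow_one]
      _ ≤ frobRoot p (Ideal.span {f ^ (p - 1)} * hslIdeal p f (n₀ + n)) 1 := by
          refine frobRoot_mono (Ideal.mul_mono_right (le_trans (Ideal.mul_mono_left ?_) ih)) 1
          rw [Ideal.span_singleton_le_span_singleton]
          -- The exponent 2 is reproduced because `x ^ p` is a multiple of `x ^ 2`.
          exact pow_dvd_pow x hp
      _ = hslIdeal p f (n₀ + (n + 1)) := by rw [← hslIdeal_succ H, add_assoc]

/-! ### Test ideals and `F`-jumping numbers of a principal ideal -/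

section TestIdeals

set_option linter.unusedSectionVars false

variable {R : Type*} [CommRing R] {p : ℕ} [Fact p.Prime] [CharP R p]

theorem frobRoot_span_pow_mul (H : HasFrobeniusCoordinates R p) (f : R) (a e k : ℕ) :
    frobRoot p (Ideal.span {f ^ (a * p ^ k)}) (e + k) = frobRoot p (Ideal.span {f ^ a}) e := by
  rw [pow_mul, ← frobPower_span_singleton, add_comm, ← frobRoot_frobRoot H, frobRoot_frobPower H]

theorem frobRoot_span_pow_antitone (f : R) (e : ℕ) :
    Antitone fun a ↦ frobRoot p (Ideal.span {f ^ a}) e := fun a b hab ↦ by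
  refine frobRoot_mono ?_ e
  rw [Ideal.span_singleton_le_span_singleton]
  exact pow_dvd_pow f hab

/-- The `e`-th approximation to the test ideal `τ(f ^ lam)`. -/
def testApprox (p : ℕ) (f : R) (lam : ℝ) (e : ℕ) : Ideal R :=
  frobRoot p (Ideal.span {f ^ ⌈lam * (p : ℝ) ^ e⌉₊}) e

theorem testApprox_monotone (H : HasFrobeniusCoordinates R p) (f : R) (lam : ℝ) :
    Monotone (testApprox p f lam) := by
  refine monotone_nat_of_le_succ fun e ↦ ?_
  rw [testApprox, ← frobRoot_span_pow_mul H f _ e 1]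
  refine frobRoot_span_pow_antitone f (e + 1) (Nat.ceil_le.2 ?_)
  rw [pow_succ, ← mul_assoc, pow_one, Nat.cast_mul]
  exact mul_le_mul_of_nonneg_right (Nat.le_ceil _) (Nat.cast_nonneg p)

theorem testIdeal_eq_iSup (f : R) (lam : ℝ) :
    testIdeal p (Ideal.span {f}) lam = ⨆ e : ℕ, ⨆ _ : 1 ≤ e, testApprox p f lam e := by
  simp only [testIdeal, testApprox, Ideal.span_singleton_pow]

theorem testApprox_le_testIdeal (f : R) (lam : ℝ) {e : ℕ} (he : 1 ≤ e) :
    testApprox p f lam e ≤ testIdeal p (Ideal.span {f}) lam := by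
  rw [testIdeal_eq_iSup]
  exact le_iSup₂_of_le e he le_rfl

theorem exists_testIdeal_eq [IsNoetherianRing R] (H : HasFrobeniusCoordinates R p) (f : R)
    (lam : ℝ) : ∃ e, 1 ≤ e ∧ testIdeal p (Ideal.span {f}) lam = testApprox p f lam e := by
  obtain ⟨n, hn⟩ := monotone_stabilizes_iff_noetherian.2 (inferInstance : IsNoetherianRing R)
    ⟨testApprox p f lam, testApprox_monotone H f lam⟩
  refine ⟨n + 1, n.succ_pos, le_antisymm ?_ (testApprox_le_testIdeal f lam n.succ_pos)⟩
  rw [testIdeal_eq_iSup]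
  refine iSup₂_le fun e _ ↦ (testApprox_monotone H f lam (le_max_left e (n + 1))).trans ?_
  exact ((hn _ (n.le_succ.trans (le_max_right e (n + 1)))).symm.trans (hn _ n.le_succ)).le

theorem testIdeal_antitone (f : R) : Antitone (testIdeal p (Ideal.span {f})) := by
  intro lam mu h
  rw [testIdeal_eq_iSup, testIdeal_eq_iSup]
  refine iSup₂_mono fun e _ ↦ frobRoot_span_pow_antitone f e (Nat.ceil_mono ?_)
  gcongr

/-- For the exponent `a / p^e` the ceilings are exact from level `e` on, so the approximating chain
is constant there. -/
theorem testIdeal_div (H : HasFrobeniusCoordinates R p) (f : R) (a : ℕ) {e : ℕ} (he : 1 ≤ e) :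
    testIdeal p (Ideal.span {f}) (a / (p : ℝ) ^ e) = frobRoot p (Ideal.span {f ^ a}) e := by
  have hp : (p : ℝ) ≠ 0 := Nat.cast_ne_zero.2 (Fact.out : p.Prime).ne_zero
  have key (k : ℕ) : testApprox p f (a / (p : ℝ) ^ e) (e + k) =
      frobRoot p (Ideal.span {f ^ a}) e := by
    rw [testApprox, ← frobRoot_span_pow_mul H f a e k]
    congr 4
    rw [pow_add, ← mul_assoc, div_mul_cancel₀ _ (pow_ne_zero e hp)]
    exact_mod_cast Nat.ceil_natCast _
  refine le_antisymm ?_ ((key 0).ge.trans (testApprox_le_testIdeal f _ he))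
  rw [testIdeal_eq_iSup]
  refine iSup₂_le fun k _ ↦ ?_
  rw [← key k]
  exact testApprox_monotone H f _ (Nat.le_add_left k e)

theorem testIdeal_one_sub (H : HasFrobeniusCoordinates R p) (f : R) {e : ℕ} (he : 1 ≤ e) :
    testIdeal p (Ideal.span {f}) (1 - 1 / (p : ℝ) ^ e) = hslIdeal p f e := by
  have hp : 0 < p := (Fact.out : p.Prime).pos
  rw [hslIdeal, ← testIdeal_div H f _ he, Nat.cast_sub (Nat.one_le_pow e p hp)]
  congr 1
  have : (p : ℝ) ≠ 0 := by positivity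
  field_simp
  simp

/-- Otherwise `f` lies in `𝔪^{[p^k]} ⊆ 𝔪^(p^k)` for all `k`, against Krull's intersection theorem.
-/
theorem exists_frobRoot_eq_top [IsNoetherianRing R] [IsLocalRing R]
    (H : HasFrobeniusCoordinates R p) {f : R} (hf : f ≠ 0) :
    ∃ k, frobRoot p (Ideal.span {f}) k = ⊤ := by
  have hp : p.Prime := Fact.out
  by_contra! h
  refine hf ?_
  have hbot := Ideal.iInf_pow_eq_bot_of_isLocalRing (maximalIdeal R)
    (maximalIdeal.isMaximal R).ne_top
  rw [← Ideal.mem_bot, ← hbot, Ideal.mem_iInf]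
  intro i
  have hi : f ∈ frobPower p (maximalIdeal R) i := by
    rw [← Ideal.span_singleton_le_iff_mem, le_frobPower_iff H]
    exact le_maximalIdeal (h i)
  exact Ideal.pow_le_pow_right (Nat.lt_pow_self hp.one_lt).le (frobPower_le_pow p _ i hi)

/-- Right continuity of test ideals. -/
theorem exists_testIdeal_eq_of_lt [IsNoetherianRing R] [IsLocalRing R]
    (H : HasFrobeniusCoordinates R p) {f : R} (hf : f ≠ 0) (lam : ℝ) :
    ∃ mu, lam < mu ∧ testIdeal p (Ideal.span {f}) mu = testIdeal p (Ideal.span {f}) lam := by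
  have hp : (0 : ℝ) < p := Nat.cast_pos.2 (Fact.out : p.Prime).pos
  obtain ⟨e, he, h⟩ := exists_testIdeal_eq H f lam
  obtain ⟨k, hk⟩ := exists_frobRoot_eq_top H hf
  set a := ⌈lam * (p : ℝ) ^ e⌉₊ with ha
  -- The numerator carries one extra factor `f`. It costs nothing at level `e + k`, since the `k`-th
  -- root of `(f)` is the whole ring.
  have hlt : lam < ((a * p ^ k + 1 : ℕ) : ℝ) / (p : ℝ) ^ (e + k) := by
    rw [lt_div_iff₀ (by positivity), pow_add, ← mul_assoc]
    push_cast
    refine lt_of_le_of_lt ?_ (lt_add_one _)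
    gcongr
    exact Nat.le_ceil _
  refine ⟨_, hlt, le_antisymm (testIdeal_antitone f hlt.le) ?_⟩
  rw [testIdeal_div H f _ (he.trans (Nat.le_add_right e k)), h, testApprox, ← ha, add_comm e k,
    ← frobRoot_frobRoot H, pow_succ, ← Ideal.span_singleton_mul_span_singleton, pow_mul,
    ← frobPower_span_singleton, frobRoot_frobPower_mul H, hk, Ideal.mul_top]

theorem exists_isFJumpingNumber [IsNoetherianRing R] [IsLocalRing R]
    (H : HasFrobeniusCoordinates R p) {f : R} (hf : f ≠ 0) {b c : ℝ} (hb : 0 ≤ b) (hbc : b ≤ c)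
    (h : testIdeal p (Ideal.span {f}) b ≠ testIdeal p (Ideal.span {f}) c) :
    ∃ lam, b < lam ∧ lam ≤ c ∧ IsFJumpingNumber p (Ideal.span {f}) lam := by
  let T : Set ℝ := {nu | testIdeal p (Ideal.span {f}) nu = testIdeal p (Ideal.span {f}) c}
  have hcT : c ∈ T := rfl
  have hbT {nu : ℝ} (hnu : nu ∈ T) : b < nu := by
    by_contra! hle
    exact h (le_antisymm ((testIdeal_antitone f hle).trans hnu.le) (testIdeal_antitone f hbc))
  have hbdd : BddBelow T := ⟨b, fun nu hnu ↦ (hbT hnu).le⟩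
  have hle : sInf T ≤ c := csInf_le hbdd hcT
  obtain ⟨mu, hmu, hmueq⟩ := exists_testIdeal_eq_of_lt H hf (sInf T)
  obtain ⟨nu, hnu, hnumu⟩ := exists_lt_of_csInf_lt ⟨c, hcT⟩ hmu
  -- Right continuity makes the infimum a minimum; this minimum is the jumping number.
  have hmem : sInf T ∈ T := by
    refine le_antisymm ?_ (testIdeal_antitone f hle)
    rw [← hmueq]
    exact (testIdeal_antitone f hnumu.le).trans hnu.le
  refine ⟨sInf T, hbT hmem, hle, hb.trans_lt (hbT hmem), fun mu _ hlt heq ↦ ?_⟩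
  exact hlt.not_ge (csInf_le hbdd (heq.symm.trans hmem))

theorem testIdeal_stable_iff_forall_not_isFJumpingNumber [IsNoetherianRing R] [IsLocalRing R]
    (H : HasFrobeniusCoordinates R p) {f : R} (hf : f ≠ 0) {l : ℕ} :
    (∀ i : ℕ, 1 ≤ i →
        testIdeal p (Ideal.span {f}) (1 - 1 / (p : ℝ) ^ l) =
          testIdeal p (Ideal.span {f}) (1 - 1 / (p : ℝ) ^ (l + i))) ↔
      ∀ lam ∈ Set.Ioo (1 - 1 / (p : ℝ) ^ l) 1, ¬ IsFJumpingNumber p (Ideal.span {f}) lam := by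
  have hp1 : (1 : ℝ) < p := Nat.one_lt_cast.2 (Fact.out : p.Prime).one_lt
  have hp : (0 : ℝ) < p := one_pos.trans hp1
  have hnonneg : 0 ≤ 1 - 1 / (p : ℝ) ^ l := by
    rw [sub_nonneg, div_le_one (by positivity)]
    exact one_le_pow₀ hp1.le
  constructor
  · rintro h lam ⟨hl, hlam⟩ ⟨_, hjump⟩
    -- With `p^(-n) < 1 - lam`, the number `lam` is squeezed between `1 - 1/p^l` and `1 -
    -- 1/p^(l+n+1)`, where the test ideals agree.
    obtain ⟨n, hn⟩ := exists_pow_lt_of_lt_one (sub_pos.2 hlam) (inv_lt_one_of_one_lt₀ hp1)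
    have hle : lam ≤ 1 - 1 / (p : ℝ) ^ (l + (n + 1)) := by
      have : 1 / (p : ℝ) ^ (l + (n + 1)) ≤ (p : ℝ)⁻¹ ^ n := by
        rw [inv_pow, ← one_div]
        gcongr
        · exact hp1.le
        · omega
      linarith
    refine hjump _ hnonneg hl (le_antisymm (testIdeal_antitone f hl.le) ?_)
    rw [h (n + 1) n.succ_pos]
    exact testIdeal_antitone f hle
  · intro h i _
    by_contra hne
    obtain ⟨lam, h1, h2, h3⟩ := exists_isFJumpingNumber H hf hnonneg
      (sub_le_sub_left (one_div_le_one_div_of_le (by positivity)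
        (pow_le_pow_right₀ hp1.le (Nat.le_add_right l i))) 1) hne
    exact h lam ⟨h1, h2.trans_lt (sub_lt_self 1 (by positivity))⟩ h3

end TestIdeals

/-! ### Regular local rings -/

section RegularLocalRings

open RingTheory.Sequence

theorem IsRegularLocalRing.maximalIdeal_eq_bot {R : Type*} [CommRing R] [IsRegularLocalRing R]
    (h : ringKrullDim R = 0) : maximalIdeal R = ⊥ := by
  have h1 := IsRegularLocalRing.spanFinrank_maximalIdeal (R := R)
  rw [h, Nat.cast_eq_zero] at h1
  exact (Submodule.spanFinrank_eq_zero_iff_eq_bot (IsNoetherian.noetherian _)).1 h1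

theorem IsLocalRing.ringKrullDim_eq_zero_of_maximalIdeal_mem_minimalPrimes_bot {R : Type*}
    [CommRing R] [IsLocalRing R] (h : maximalIdeal R ∈ (⊥ : Ideal R).minimalPrimes) :
    ringKrullDim R = 0 := by
  rw [← maximalIdeal_height_eq_ringKrullDim, Ideal.height_eq_zero_iff.2 h]
  rfl

theorem IsRegularLocalRing.exists_mem_maximalIdeal {R : Type*} [CommRing R] [IsRegularLocalRing R]
    (hdim : ringKrullDim R ≠ 0) {I : Ideal R} (hI : maximalIdeal R ∉ I.minimalPrimes) :
    ∃ y ∈ maximalIdeal R, y ∉ maximalIdeal R ^ 2 ∧ ∀ P ∈ I.minimalPrimes, y ∉ P := by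
  classical
  by_contra! h
  have hfin := Ideal.finite_minimalPrimes_of_isNoetherianRing R I
  have hsub : (maximalIdeal R : Set R) ⊆
      ⋃ J ∈ ((insert (maximalIdeal R ^ 2) hfin.toFinset : Finset (Ideal R)) : Set (Ideal R)),
        ((id J : Ideal R) : Set R) := by
    intro y hy
    simp only [Set.mem_iUnion]
    by_cases hy2 : y ∈ maximalIdeal R ^ 2
    · exact ⟨_, by simp, hy2⟩
    · obtain ⟨P, hP, hyP⟩ := h y hy hy2
      exact ⟨P, by simp [hP], hyP⟩
  -- Prime avoidance tolerates `𝔪 ^ 2` as an exceptional non-prime member.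
  rw [Ideal.subset_union_prime (maximalIdeal R ^ 2) (maximalIdeal R ^ 2)] at hsub
  · obtain ⟨J, hJ, hle⟩ := hsub
    rw [Finset.mem_insert, Set.Finite.mem_toFinset] at hJ
    obtain rfl | hJ := hJ
    · have hbot : maximalIdeal R = ⊥ := by
        refine Submodule.eq_bot_of_le_smul_of_le_jacobson_bot (maximalIdeal R) _
          (IsNoetherian.noetherian _) ?_ (maximalIdeal_le_jacobson _)
        rw [smul_eq_mul, ← pow_two]
        exact hle
      refine hdim (IsLocalRing.ringKrullDim_eq_zero_of_maximalIdeal_mem_minimalPrimes_bot ?_)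
      exact ⟨⟨inferInstance, bot_le⟩, fun _ _ _ ↦ hbot.le.trans bot_le⟩
    · have : J = maximalIdeal R :=
        (le_maximalIdeal hJ.1.1.ne_top).antisymm hle
      exact hI (this ▸ hJ)
  · intro J hJ hne _
    rw [Finset.mem_insert, Set.Finite.mem_toFinset] at hJ
    exact (hJ.resolve_left hne).1.1

/-- As `y ∉ 𝔪 ^ 2`, some coefficient of `y` on minimal generators of `𝔪` is a unit, so that
generator is redundant modulo `y`; the dimension falls by at most one. -/
theorem IsRegularLocalRing.quotient_span_singleton {R : Type*} [CommRing R] [IsRegularLocalRing R]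
    {n : ℕ} (hdim : ringKrullDim R = (n + 1 : ℕ)) {y : R} (hy : y ∈ maximalIdeal R)
    (hy2 : y ∉ maximalIdeal R ^ 2) :
    IsRegularLocalRing (R ⧸ Ideal.span {y}) ∧ ringKrullDim (R ⧸ Ideal.span {y}) = n := by
  have := isLocalRing_quotient_span hy
  have hfg : (maximalIdeal R).FG := IsNoetherian.noetherian _
  obtain ⟨s, hs, hspan⟩ : ∃ s : Finset R, s.card = n + 1 ∧
      Ideal.span (s : Set R) = maximalIdeal R := by
    have hfin := Submodule.FG.finite_generators hfg
    refine ⟨hfin.toFinset, ?_, ?_⟩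
    · rw [← Set.ncard_eq_toFinset_card _ hfin, Submodule.FG.generators_ncard hfg]
      exact_mod_cast (IsRegularLocalRing.spanFinrank_maximalIdeal (R := R)).trans hdim
    · rw [Set.Finite.coe_toFinset]
      exact Submodule.span_generators _
  classical
  have hmem (z : R) (hz : z ∈ s) : z ∈ maximalIdeal R := hspan ▸ Ideal.subset_span hz
  obtain ⟨c, hc⟩ := (Submodule.mem_span_finset.1 (hspan.ge hy))
  replace hc := hc.2
  obtain ⟨g, hg, hunit⟩ : ∃ g ∈ s, IsUnit (c g) := by
    by_contra! h
    refine hy2 (hc ▸ Ideal.sum_mem _ fun z hz ↦ ?_)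
    rw [smul_eq_mul, pow_two]
    exact Ideal.mul_mem_mul ((mem_maximalIdeal _).2 (h z hz)) (hmem z hz)
  let mk := Ideal.Quotient.mk (Ideal.span {y})
  have hmap : maximalIdeal (R ⧸ Ideal.span {y}) = Ideal.span (mk '' (s.erase g : Finset R)) := by
    rw [← IsLocalRing.map_maximalIdeal_of_surjective mk Ideal.Quotient.mk_surjective, ← hspan,
      Ideal.map_span]
    refine le_antisymm (Ideal.span_le.2 ?_) (Ideal.span_mono (Set.image_mono ?_))
    · rintro _ ⟨z, hz, rfl⟩
      by_cases hzg : z = g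
      · subst hzg
        have h0 : mk (c z) * mk z + ∑ x ∈ s.erase z, mk (c x) * mk x = 0 := by
          have : mk y = 0 := Ideal.Quotient.eq_zero_iff_mem.2 (Ideal.mem_span_singleton_self y)
          simpa [← Finset.add_sum_erase s _ hg, hc] using (congrArg mk hc).trans this
        have hu : IsUnit (mk (c z)) := hunit.map mk
        rw [SetLike.mem_coe, ← Ideal.unit_mul_mem_iff_mem _ hu, eq_neg_of_add_eq_zero_left h0]
        exact neg_mem (Ideal.sum_mem _ fun x hx ↦
          Ideal.mul_mem_left _ _ (Ideal.subset_span ⟨x, hx, rfl⟩))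
      · exact Ideal.subset_span ⟨z, by simpa [hzg] using hz, rfl⟩
    · exact_mod_cast s.erase_subset g
  have hle : (maximalIdeal (R ⧸ Ideal.span {y})).spanFinrank ≤ n := by
    rw [hmap]
    refine (Submodule.spanFinrank_span_le_ncard_of_finite ((Finset.finite_toSet _).image _)).trans ?_
    refine (Set.ncard_image_le (Finset.finite_toSet _)).trans ?_
    rw [Set.ncard_coe_finset, Finset.card_erase_of_mem hg, hs, Nat.add_sub_cancel]
  have hge : (n : WithBot ℕ∞) ≤ ringKrullDim (R ⧸ Ideal.span {y}) := by
    have h1 := ringKrullDim_le_ringKrullDim_quotient_add_card (R := R) {y}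
      (by simpa [IsLocalRing.ringJacobson_eq_maximalIdeal] using hy)
    rw [hdim, Finset.coe_singleton, Finset.card_singleton] at h1
    exact ENat.WithBot.add_le_add_natCast_right_iff.mp (by exact_mod_cast h1)
  have hle' := ringKrullDim_le_spanFinrank_maximalIdeal (R ⧸ Ideal.span {y})
  have hcast : ((maximalIdeal (R ⧸ Ideal.span {y})).spanFinrank : WithBot ℕ∞) ≤ n := by
    exact_mod_cast hle
  exact ⟨.of_spanFinrank_maximalIdeal_le _ (hcast.trans hge), (hle'.trans hcast).antisymm hge⟩

theorem IsRegularLocalRing.exists_ringKrullDim_eq (R : Type*) [CommRing R] [IsRegularLocalRing R] :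
    ∃ n : ℕ, ringKrullDim R = n :=
  ⟨_, (IsRegularLocalRing.spanFinrank_maximalIdeal (R := R)).symm⟩

theorem IsRegularLocalRing.isDomain (R : Type*) [CommRing R] [IsRegularLocalRing R] :
    IsDomain R := by
  obtain ⟨n, hn⟩ := IsRegularLocalRing.exists_ringKrullDim_eq R
  induction n generalizing R with
  | zero =>
    have h := IsRegularLocalRing.maximalIdeal_eq_bot (by simpa using hn)
    have : (⊥ : Ideal R).IsPrime := h ▸ inferInstance
    exact IsDomain.of_bot_isPrime R
  | succ n ih =>
    have hdim : ringKrullDim R ≠ 0 := by rw [hn]; exact_mod_cast n.succ_ne_zero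
    obtain ⟨y, hy, hy2, hyP⟩ := IsRegularLocalRing.exists_mem_maximalIdeal hdim (I := ⊥)
      (mt IsLocalRing.ringKrullDim_eq_zero_of_maximalIdeal_mem_minimalPrimes_bot hdim)
    obtain ⟨hreg, hdim'⟩ := IsRegularLocalRing.quotient_span_singleton hn hy hy2
    have := ih _ hdim'
    have hprime : (Ideal.span {y}).IsPrime := (Ideal.Quotient.isDomain_iff_prime _).1 this
    obtain ⟨P, hP, hPy⟩ := Ideal.exists_minimalPrimes_le (bot_le (a := Ideal.span {y}))
    have hPprime : P.IsPrime := hP.1.1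
    -- The minimal prime `P` lies in the prime `(y)` but misses `y`, so `P = yP` and Nakayama
    -- applies.
    have hbot : P = ⊥ := by
      refine Submodule.eq_bot_of_le_smul_of_le_jacobson_bot (Ideal.span {y}) _
          (IsNoetherian.noetherian _) (fun x hx ↦ ?_)
          (((Ideal.span_singleton_le_iff_mem _).2 hy).trans (maximalIdeal_le_jacobson _))
      obtain ⟨c, rfl⟩ := Ideal.mem_span_singleton'.1 (hPy hx)
      rw [smul_eq_mul, mul_comm c]
      exact Ideal.mul_mem_mul (Ideal.mem_span_singleton_self y)
        ((hPprime.mem_or_mem hx).resolve_right (hyP P hP))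
    have : (⊥ : Ideal R).IsPrime := hbot ▸ hPprime
    exact IsDomain.of_bot_isPrime R

/-- `rs` is a system of parameters of the local ring `R`, presented as a list. -/
structure IsParameterList {R : Type*} [CommRing R] [IsLocalRing R] (rs : List R) : Prop where
  ringKrullDim_eq : ringKrullDim R = rs.length
  radical_eq : (Ideal.ofList rs).radical = maximalIdeal R

theorem Ideal.ofList_perm {R : Type*} [CommRing R] {rs rs' : List R} (h : rs.Perm rs') :
    Ideal.ofList rs = Ideal.ofList rs' := by
  simp only [Ideal.ofList, h.mem_iff]

theorem IsParameterList.perm {R : Type*} [CommRing R] [IsLocalRing R] {rs rs' : List R}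
    (h : IsParameterList rs) (hp : rs.Perm rs') : IsParameterList rs' :=
  ⟨h.1.trans (by rw [hp.length_eq]), by rw [← Ideal.ofList_perm hp, h.2]⟩

theorem IsParameterList.mem {R : Type*} [CommRing R] [IsLocalRing R] {rs : List R}
    (h : IsParameterList rs) {r : R} (hr : r ∈ rs) : r ∈ maximalIdeal R :=
  h.radical_eq ▸ Ideal.le_radical (Ideal.subset_span hr)

theorem IsParameterList.maximalIdeal_notMem_minimalPrimes {R : Type*} [CommRing R] [IsLocalRing R]
    [IsNoetherianRing R] {x : R} {rs : List R} (h : IsParameterList (x :: rs)) :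
    maximalIdeal R ∉ (Ideal.ofList rs).minimalPrimes := by
  classical
  intro hm
  have h1 : (maximalIdeal R).height ≤ rs.toFinset.card := by
    refine Ideal.height_le_card_of_mem_minimalPrimes_span_finset ?_
    rwa [List.coe_toFinset]
  have h2 : ((maximalIdeal R).height : WithBot ℕ∞) ≤ (rs.length : ℕ) := by
    exact_mod_cast h1.trans (by exact_mod_cast List.toFinset_card_le rs)
  rw [maximalIdeal_height_eq_ringKrullDim, h.ringKrullDim_eq] at h2
  have h3 : (x :: rs).length ≤ rs.length := by exact_mod_cast h2
  simp at h3

/-- Exchange `x` for a generic regular parameter `y`. -/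
theorem IsRegularLocalRing.exists_isParameterList_exchange {R : Type*} [CommRing R]
    [IsRegularLocalRing R] {x : R} {rs : List R} (h : IsParameterList (x :: rs)) :
    ∃ y : R, IsParameterList (y :: rs) ∧
      ∃ _ : IsRegularLocalRing (R ⧸ Ideal.span {y}),
        IsParameterList (rs.map (Ideal.Quotient.mk (Ideal.span {y}))) := by
  have hdim := h.ringKrullDim_eq
  rw [List.length_cons] at hdim
  obtain ⟨y, hy, hy2, hyP⟩ := IsRegularLocalRing.exists_mem_maximalIdeal
    (by rw [hdim]; exact_mod_cast rs.length.succ_ne_zero) h.maximalIdeal_notMem_minimalPrimes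
  obtain ⟨hreg, hdim'⟩ := IsRegularLocalRing.quotient_span_singleton hdim hy hy2
  have hle : Ideal.ofList (y :: rs) ≤ maximalIdeal R := by
    refine Ideal.span_le.2 fun r hr ↦ ?_
    obtain rfl | hr := List.mem_cons.1 hr
    · exact hy
    · exact h.mem (List.mem_cons_of_mem x hr)
  -- By Krull's height theorem `R / (rs)` has dimension at most one: its maximal ideal is minimal
  -- over the image of `x`. A prime over `(rs)` that contains `y` is not minimal over `(rs)`, so it
  -- is maximal.
  have hKrull : Ring.KrullDimLE 1 (R ⧸ Ideal.ofList rs) := by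
    have hne : Ideal.ofList rs ≠ ⊤ := fun htop ↦ (maximalIdeal.isMaximal R).ne_top <|
      top_le_iff.1 (htop ▸ (Ideal.span_mono fun r hr ↦ List.mem_cons_of_mem y hr).trans hle)
    have : Nontrivial (R ⧸ Ideal.ofList rs) := Ideal.Quotient.nontrivial_iff.2 hne
    have : IsLocalRing (R ⧸ Ideal.ofList rs) :=
      IsLocalRing.of_surjective' _ Ideal.Quotient.mk_surjective
    rw [Ring.krullDimLE_iff, ← maximalIdeal_height_eq_ringKrullDim,
      ← IsLocalRing.map_maximalIdeal_of_surjective _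
        (Ideal.Quotient.mk_surjective (I := Ideal.ofList rs))]
    have hmin : maximalIdeal R ∈ (Ideal.ofList rs ⊔ Ideal.span {x}).minimalPrimes := by
      rw [sup_comm, ← Ideal.ofList_cons, ← Ideal.radical_minimalPrimes, h.radical_eq]
      exact Ideal.minimalPrimes_eq_subsingleton_self.ge rfl
    exact_mod_cast Ideal.map_height_le_one_of_mem_minimalPrimes hmin
  have hrad : (Ideal.ofList (y :: rs)).radical = maximalIdeal R := by
    refine le_antisymm ((maximalIdeal.isMaximal R).isPrime.radical_le_iff.2 hle) ?_
    rw [Ideal.radical_eq_sInf]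
    refine le_sInf ?_
    rintro Q ⟨hQ, hQprime⟩
    rw [Ideal.ofList_cons, sup_le_iff, Ideal.span_singleton_le_iff_mem] at hQ
    have hcomap : (Q.map (Ideal.Quotient.mk (Ideal.ofList rs))).comap (Ideal.Quotient.mk _) = Q :=
      by rw [Ideal.comap_map_mk hQ.2]
    have hQ' : (Q.map (Ideal.Quotient.mk (Ideal.ofList rs))).IsPrime :=
      Ideal.map_isPrime_of_surjective Ideal.Quotient.mk_surjective (by simpa using hQ.2)
    obtain hmin | hmax := Ring.krullDimLE_one_iff.1 hKrull _ hQ'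
    · refine absurd hQ.1 (hyP Q ?_)
      rw [Ideal.minimalPrimes_eq_comap]
      exact ⟨_, hmin, hcomap⟩
    · have := Ideal.comap_isMaximal_of_surjective _
        (Ideal.Quotient.mk_surjective (I := Ideal.ofList rs)) (K := Q.map (Ideal.Quotient.mk (Ideal.ofList rs)))
      rw [hcomap] at this
      exact (IsLocalRing.eq_maximalIdeal this).ge
  refine ⟨y, ⟨hdim, hrad⟩, hreg, ?_, ?_⟩
  · rw [hdim', List.length_map]
  · rw [← IsLocalRing.map_maximalIdeal_of_surjective _
      (Ideal.Quotient.mk_surjective (I := Ideal.span {y})), ← hrad,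
      Ideal.map_radical_of_surjective Ideal.Quotient.mk_surjective, Ideal.ofList_cons,
      Ideal.map_sup, Ideal.map_quotient_self, bot_sup_eq, Ideal.map_ofList]
    rw [Ideal.mk_ker, Ideal.ofList_cons]
    exact le_sup_left

/-- Regularity modulo `I` passes from `y` to `x`: some `y ^ n` is a multiple of `x` modulo `I`, so
it kills whatever `x` kills. -/
theorem mem_of_mul_mem_of_mem_radical {R : Type*} [CommRing R] {I : Ideal R} {x y a : R}
    (hy : ∀ b, y * b ∈ I → b ∈ I) (hxy : y ∈ (Ideal.span {x} ⊔ I).radical) (ha : x * a ∈ I) :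
    a ∈ I := by
  obtain ⟨n, hn⟩ := hxy
  obtain ⟨_, hc, i, hi, hsum⟩ := Submodule.mem_sup.1 hn
  obtain ⟨c, rfl⟩ := Ideal.mem_span_singleton'.1 hc
  have hpow (k : ℕ) (b : R) (h : y ^ k * b ∈ I) : b ∈ I := by
    induction k with
    | zero => simpa using h
    | succ k ih => exact ih (hy _ (by rwa [← mul_assoc, ← pow_succ']))
  refine hpow n a ?_
  rw [← hsum, add_mul, mul_assoc]
  exact I.add_mem (I.mul_mem_left c ha) (I.mul_mem_right a hi)

theorem isWeaklyRegular_append_singleton_iff {R : Type*} [CommRing R] {rs : List R} {x : R} :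
    IsWeaklyRegular R (rs ++ [x]) ↔
      IsWeaklyRegular R rs ∧ ∀ a, x * a ∈ Ideal.ofList rs → a ∈ Ideal.ofList rs := by
  rw [isWeaklyRegular_append_iff, isWeaklyRegular_singleton_iff,
    isSMulRegular_quotient_iff_mem_of_smul_mem]
  simp

theorem isWeaklyRegular_cons_iff_quotient {R : Type*} [CommRing R] {rs : List R} {y : R} :
    IsWeaklyRegular R (y :: rs) ↔ IsSMulRegular R y ∧
      IsWeaklyRegular (R ⧸ Ideal.span {y}) (rs.map (Ideal.Quotient.mk (Ideal.span {y}))) := by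
  rw [isWeaklyRegular_cons_iff]
  have e : QuotSMulTop y R ≃ₗ[R] R ⧸ Ideal.span {y} := Submodule.quotEquivOfEq _ _ (by
    rw [← Submodule.ideal_span_singleton_smul, smul_eq_mul, Ideal.mul_top])
  rw [e.isWeaklyRegular_congr, ← isWeaklyRegular_map_algebraMap_iff (R ⧸ Ideal.span {y})]
  rfl

/-- Regular local rings are Cohen–Macaulay. -/
theorem IsParameterList.isWeaklyRegular {R : Type*} [CommRing R] [IsRegularLocalRing R]
    {rs : List R} (h : IsParameterList rs) : IsWeaklyRegular R rs := by
  obtain ⟨n, hn⟩ : ∃ n, rs.length = n := ⟨_, rfl⟩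
  induction n generalizing R with
  | zero => rw [List.length_eq_zero_iff.1 hn]; exact IsWeaklyRegular.nil R R
  | succ n ih =>
    obtain _ | ⟨x, rs⟩ := rs
    · simp at hn
    obtain ⟨y, hy, hreg, hmap⟩ := IsRegularLocalRing.exists_isParameterList_exchange h
    have := IsRegularLocalRing.isDomain R
    have hy0 : IsSMulRegular R y := by
      refine IsSMulRegular.of_ne_zero ?_
      rintro rfl
      have h1 := ringKrullDim_eq_of_ringEquiv (RingEquiv.quotientBot R)
      rw [← Ideal.span_singleton_eq_bot.2 (rfl : (0 : R) = 0), hmap.ringKrullDim_eq,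
        h.ringKrullDim_eq, List.length_map, List.length_cons] at h1
      have h2 : rs.length = rs.length + 1 := by exact_mod_cast h1
      omega
    have h1 : IsWeaklyRegular R (y :: rs) := isWeaklyRegular_cons_iff_quotient.2
      ⟨hy0, ih hmap (by simpa using hn)⟩
    -- In a local ring a regular sequence may be permuted, so `y` goes last, is replaced by `x`, and
    -- `x` is moved to the front.
    have h2 : IsWeaklyRegular R (rs ++ [y]) := isWeaklyRegular_of_perm_of_subset_maximalIdeal h1
      (List.perm_append_singleton y rs).symm (fun r hr ↦ hy.mem hr)
    rw [isWeaklyRegular_append_singleton_iff] at h2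
    refine isWeaklyRegular_of_perm_of_subset_maximalIdeal (rs := rs ++ [x])
      (isWeaklyRegular_append_singleton_iff.2 ⟨h2.1, fun a ha ↦ ?_⟩)
      (List.perm_append_singleton x rs)
      (fun r hr ↦ h.mem ((List.perm_append_singleton x rs).mem_iff.1 hr))
    refine mem_of_mul_mem_of_mem_radical h2.2 ?_ ha
    rw [← Ideal.ofList_cons, h.radical_eq]
    exact hy.mem List.mem_cons_self

theorem IsParameterList.mem_of_mul_mem {R : Type*} [CommRing R] [IsRegularLocalRing R]
    {x : R} {rs : List R} (h : IsParameterList (x :: rs)) {a : R}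
    (ha : x * a ∈ Ideal.ofList rs) : a ∈ Ideal.ofList rs :=
  (isWeaklyRegular_append_singleton_iff.1
    (h.perm (List.perm_append_singleton x rs).symm).isWeaklyRegular).2 a ha

/-- The socle of `R / Q` is generated by any of its nonzero elements. -/
def HasSimpleSocle {R : Type*} [CommRing R] [IsLocalRing R] (Q : Ideal R) : Prop :=
  ∀ a b : R, (∀ r ∈ maximalIdeal R, r * a ∈ Q) → (∀ r ∈ maximalIdeal R, r * b ∈ Q) → a ∉ Q →
    ∃ u, b - u * a ∈ Q

theorem exists_sub_mul_mem {R : Type*} [CommRing R] {I : Ideal R} {x a : R}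
    (h : a ∈ Ideal.span {x} ⊔ I) : ∃ c, a - x * c ∈ I := by
  obtain ⟨_, hc, i, hi, rfl⟩ := Submodule.mem_sup.1 h
  obtain ⟨c, rfl⟩ := Ideal.mem_span_singleton'.1 hc
  exact ⟨c, by simpa [mul_comm] using hi⟩

theorem mem_span_singleton_sup_of_sub_mul_mem {R : Type*} [CommRing R] {I : Ideal R} {x a c : R}
    (h : a - x * c ∈ I) : a ∈ Ideal.span {x} ⊔ I := by
  rw [← sub_add_cancel a (x * c)]
  exact add_mem (Ideal.mem_sup_right h)
    (Ideal.mem_sup_left (Ideal.mul_mem_right _ _ (Ideal.mem_span_singleton_self x)))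

/-- If `x` and `y` are nonzerodivisors modulo `I`, the socles of `R / (x, I)` and `R / (y, I)` are
isomorphic. -/
theorem HasSimpleSocle.exchange {R : Type*} [CommRing R] [IsLocalRing R] {I : Ideal R} {x y : R}
    (hym : y ∈ maximalIdeal R) (hx : ∀ b, x * b ∈ I → b ∈ I)
    (hy : ∀ b, y * b ∈ I → b ∈ I) (h : HasSimpleSocle (Ideal.span {y} ⊔ I)) :
    HasSimpleSocle (Ideal.span {x} ⊔ I) := by
  -- The element `a'` plays the role of `(y / x) a`, which carries one socle to the other.
  have key {a : R} (ha : ∀ r ∈ maximalIdeal R, r * a ∈ Ideal.span {x} ⊔ I) :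
      ∃ a', y * a - x * a' ∈ I ∧ ∀ r ∈ maximalIdeal R, r * a' ∈ Ideal.span {y} ⊔ I := by
    obtain ⟨a', ha'⟩ := exists_sub_mul_mem (ha y hym)
    refine ⟨a', ha', fun r hr ↦ ?_⟩
    obtain ⟨c, hc⟩ := exists_sub_mul_mem (ha r hr)
    refine mem_span_singleton_sup_of_sub_mul_mem (c := c) (hx _ ?_)
    have := I.sub_mem (I.mul_mem_left y hc) (I.mul_mem_left r ha')
    convert this using 1
    ring
  intro a b ha hb haQ
  obtain ⟨a', ha', hma'⟩ := key ha
  obtain ⟨b', hb', hmb'⟩ := key hb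
  obtain ⟨u, hu⟩ := h a' b' hma' hmb' fun hmem ↦ haQ <| by
    obtain ⟨c, hc⟩ := exists_sub_mul_mem hmem
    refine mem_span_singleton_sup_of_sub_mul_mem (c := c) (hy _ ?_)
    have := I.add_mem ha' (I.mul_mem_left x hc)
    convert this using 1
    ring
  refine ⟨u, ?_⟩
  obtain ⟨c, hc⟩ := exists_sub_mul_mem hu
  refine mem_span_singleton_sup_of_sub_mul_mem (c := c) (hy _ ?_)
  have := I.add_mem (I.sub_mem hb' (I.mul_mem_left u ha')) (I.mul_mem_left x hc)
  convert this using 1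
  ring

theorem HasSimpleSocle.comap {R : Type*} [CommRing R] [IsLocalRing R] {y : R}
    [IsLocalRing (R ⧸ Ideal.span {y})] {Q : Ideal (R ⧸ Ideal.span {y})} (h : HasSimpleSocle Q) :
    HasSimpleSocle (Q.comap (Ideal.Quotient.mk (Ideal.span {y}))) := by
  have key {a : R} (ha : ∀ r ∈ maximalIdeal R, r * a ∈ Q.comap (Ideal.Quotient.mk _)) :
      ∀ r ∈ maximalIdeal (R ⧸ Ideal.span {y}), r * Ideal.Quotient.mk _ a ∈ Q := by
    intro r hr
    obtain ⟨r, rfl⟩ := Ideal.Quotient.mk_surjective r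
    rw [← map_mul]
    refine ha r ?_
    rw [mem_maximalIdeal, mem_nonunits_iff] at hr ⊢
    exact fun hu ↦ hr (hu.map _)
  intro a b ha hb haQ
  obtain ⟨u, hu⟩ := h _ _ (key ha) (key hb) haQ
  obtain ⟨u, rfl⟩ := Ideal.Quotient.mk_surjective u
  exact ⟨u, by simpa using hu⟩

/-- Regular local rings are Gorenstein. -/
theorem IsParameterList.hasSimpleSocle {R : Type*} [CommRing R] [IsRegularLocalRing R]
    {rs : List R} (h : IsParameterList rs) : HasSimpleSocle (Ideal.ofList rs) := by
  obtain ⟨n, hn⟩ : ∃ n, rs.length = n := ⟨_, rfl⟩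
  induction n generalizing R with
  | zero =>
    obtain rfl := List.length_eq_zero_iff.1 hn
    have hbot := IsRegularLocalRing.maximalIdeal_eq_bot (by simpa using h.ringKrullDim_eq)
    intro a b _ _ ha
    have hu : IsUnit a := by
      by_contra hu
      exact ha (by simpa [hbot] using (mem_maximalIdeal a).2 hu)
    exact ⟨b * ↑hu.unit⁻¹, by simp [mul_assoc]⟩
  | succ n ih =>
    obtain _ | ⟨x, rs⟩ := rs
    · simp at hn
    obtain ⟨y, hy, hreg, hmap⟩ := IsRegularLocalRing.exists_isParameterList_exchange h
    have hs := (ih hmap (by simpa using hn)).comap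
    rw [← Ideal.map_ofList, Ideal.comap_map_of_surjective' _ Ideal.Quotient.mk_surjective,
      Ideal.mk_ker, sup_comm] at hs
    rw [Ideal.ofList_cons]
    exact HasSimpleSocle.exchange (hy.mem List.mem_cons_self)
      (fun _ ↦ h.mem_of_mul_mem) (fun _ ↦ hy.mem_of_mul_mem) hs

end RegularLocalRings

/-! ### Freeness of the Frobenius pushforward over a regular local ring -/

section Kunz

open RingTheory.Sequence

universe u v

/-- Induction down to the residue field: a finitely presented module is free once it is free modulo
a regular element of the maximal ideal. -/
theorem Module.free_of_isWeaklyRegular {R : Type u} [CommRing R] [IsLocalRing R]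
    [IsNoetherianRing R] {M : Type v} [AddCommGroup M] [Module R M] [Module.Finite R M]
    {rs : List R} (hrs : Ideal.ofList rs = maximalIdeal R) (h : IsWeaklyRegular M rs) :
    Module.Free R M := by
  obtain ⟨n, hn⟩ : ∃ n, rs.length = n := ⟨_, rfl⟩
  induction n generalizing R M with
  | zero =>
    obtain rfl := List.length_eq_zero_iff.1 hn
    have hfield : IsField R := isField_iff_maximalIdeal_eq.2 (by rw [← hrs, Ideal.ofList_nil])
    let := hfield.toField
    exact Module.Free.of_divisionRing R M
  | succ n ih =>
    obtain _ | ⟨x, rs⟩ := rs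
    · simp at hn
    have hx : x ∈ maximalIdeal R := hrs ▸ Ideal.subset_span List.mem_cons_self
    have := isLocalRing_quotient_span hx
    rw [isWeaklyRegular_cons_iff'] at h
    have : Module.Finite (R ⧸ Ideal.span {x}) (QuotSMulTop x M) :=
      Module.Finite.of_restrictScalars_finite R _ _
    have := Module.finitePresentation_of_finite R M
    rw [← Module.free_quotSMulTop_iff_free R M (maximalIdeal_le_jacobson ⊥ hx) h.1]
    refine ih ?_ h.2 (by simpa using hn)
    rw [← Ideal.map_ofList, ← IsLocalRing.map_maximalIdeal_of_surjective _
      (Ideal.Quotient.mk_surjective (I := Ideal.span {x})), ← hrs, Ideal.ofList_cons,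
      Ideal.map_sup, Ideal.map_quotient_self, bot_sup_eq]

theorem IsRegularLocalRing.exists_isParameterList (R : Type*) [CommRing R]
    [IsRegularLocalRing R] :
    ∃ rs : List R, IsParameterList rs ∧ Ideal.ofList rs = maximalIdeal R := by
  have hfg : (maximalIdeal R).FG := IsNoetherian.noetherian _
  have hfin := Submodule.FG.finite_generators hfg
  have hspan : Ideal.ofList hfin.toFinset.toList = maximalIdeal R := by
    simpa [Ideal.ofList] using! Submodule.span_generators (maximalIdeal R)
  refine ⟨hfin.toFinset.toList, ⟨?_, ?_⟩, hspan⟩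
  · rw [Finset.length_toList, ← Set.ncard_eq_toFinset_card _ hfin,
      Submodule.FG.generators_ncard hfg]
    exact (IsRegularLocalRing.spanFinrank_maximalIdeal (R := R)).symm
  · rw [hspan, (maximalIdeal.isMaximal R).isPrime.radical]

theorem IsParameterList.map_pow {R : Type*} [CommRing R] [IsLocalRing R] {rs : List R}
    (h : IsParameterList rs) {q : ℕ} (hq : q ≠ 0) : IsParameterList (rs.map (· ^ q)) := by
  refine ⟨by rw [h.1, List.length_map], ?_⟩
  rw [← h.2]
  refine le_antisymm (Ideal.radical_mono (Ideal.span_le.2 ?_))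
    (Ideal.radical_le_radical_iff.2 (Ideal.span_le.2 ?_))
  · intro r hr
    obtain ⟨s, hs, rfl⟩ := List.mem_map.1 hr
    exact Ideal.pow_mem_of_mem (Ideal.ofList rs) (Ideal.subset_span hs) q (Nat.pos_of_ne_zero hq)
  · exact fun r hr ↦ ⟨q, Ideal.subset_span (List.mem_map.2 ⟨r, hr, rfl⟩)⟩

/-- The ring `R` as an algebra over itself via the `e`-th iterate of the Frobenius. -/
def FrobeniusPushforward (R : Type*) (_p _e : ℕ) : Type _ := R

instance (R : Type*) [CommRing R] (p e : ℕ) : CommRing (FrobeniusPushforward R p e) :=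
  inferInstanceAs (CommRing R)

instance (R : Type*) [CommRing R] (p e : ℕ) [ExpChar R p] :
    Algebra R (FrobeniusPushforward R p e) :=
  RingHom.toAlgebra (S := FrobeniusPushforward R p e) (iterateFrobenius R p e)

theorem IsFFinite.iterateFrobenius {R : Type*} [CommRing R] {p : ℕ} [ExpChar R p]
    (h : IsFFinite R p) (e : ℕ) : (iterateFrobenius R p e).Finite := by
  induction e with
  | zero =>
    rw [iterateFrobenius_zero]
    exact RingHom.Finite.id R
  | succ e ih =>
    rw [iterateFrobenius_add, iterateFrobenius_one]
    exact ih.comp h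

theorem FrobeniusPushforward.free {R : Type*} [CommRing R] [IsRegularLocalRing R] {p : ℕ}
    [ExpChar R p] (e : ℕ) [Module.Finite R (FrobeniusPushforward R p e)] :
    Module.Free R (FrobeniusPushforward R p e) := by
  obtain ⟨rs, hrs, hspan⟩ := IsRegularLocalRing.exists_isParameterList R
  refine Module.free_of_isWeaklyRegular hspan ?_
  -- On the pushforward the parameters act through their `p^e`-th powers, which are again parameters
  -- and so a regular sequence.
  rw [← isWeaklyRegular_map_algebraMap_iff (FrobeniusPushforward R p e)]
  exact (hrs.map_pow (pow_pos (expChar_pos R p) e).ne').isWeaklyRegular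

theorem IsFFinite.hasFrobeniusCoordinates {R : Type*} [CommRing R] [IsRegularLocalRing R] {p : ℕ}
    [ExpChar R p] (h : IsFFinite R p) : HasFrobeniusCoordinates R p := by
  intro e
  have : Module.Finite R (FrobeniusPushforward R p e) := h.iterateFrobenius e
  have := FrobeniusPushforward.free (R := R) (p := p) e
  let b := Module.finBasis R (FrobeniusPushforward R p e)
  have hmem (J : Ideal R) (r : FrobeniusPushforward R p e) :
      r ∈ (J • ⊤ : Submodule R (FrobeniusPushforward R p e)) ↔ ∀ i, b.repr r i ∈ J := by
    constructor
    · intro hr i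
      refine Submodule.smul_induction_on hr (fun a ha s _ ↦ ?_) (fun s t hs ht ↦ ?_)
      · rw [map_smul, Finsupp.smul_apply, smul_eq_mul]
        exact J.mul_mem_right _ ha
      · rw [map_add, Finsupp.add_apply]
        exact J.add_mem hs ht
    · intro hr
      rw [← b.sum_repr r]
      exact Submodule.sum_mem _ fun i _ ↦ Submodule.smul_mem_smul (hr i) trivial
  have hsmul (i) (a : R) (r : FrobeniusPushforward R p e) : b.repr (a • r) i = a * b.repr r i := by
    simp
  refine ⟨⟨Fin _, fun i r ↦ b.repr (show FrobeniusPushforward R p e from r) i,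
    fun i a r ↦ hsmul i a r, fun J r ↦ Iff.trans ?_ (hmem J r)⟩⟩
  rw [Ideal.smul_top_eq_map, frobPower_eq_map]
  rfl

end Kunz

/-! ### Duality over Artinian local rings with a simple socle -/

section Duality

set_option linter.unusedSectionVars false

variable {R : Type*} [CommRing R] [IsLocalRing R]

theorem Module.length_residue_eq_one : Module.length R (R ⧸ maximalIdeal R) = 1 :=
  Module.length_eq_one_iff.2 (isSimpleModule_iff_quot_maximal.2
    ⟨maximalIdeal R, inferInstance, ⟨LinearEquiv.refl R _⟩⟩)

theorem length_quotient_eq_add {I J : Ideal R} (h : J ≤ I) :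
    Module.length R (R ⧸ J) = Module.length R (LinearMap.ker (Submodule.factor h)) +
      Module.length R (R ⧸ I) :=
  Module.length_eq_add_of_exact (LinearMap.ker (Submodule.factor h)).subtype
    (Submodule.factor h) (Submodule.subtype_injective _) (Submodule.factor_surjective h)
    (LinearMap.exact_subtype_ker_map _)

theorem length_quotient_le_add_one {I J : Ideal R} (h : J ≤ I) {c : R} (hI : I ≤ Ideal.span {c} ⊔ J)
    (hc : ∀ r ∈ maximalIdeal R, r * c ∈ J) :
    Module.length R (R ⧸ J) ≤ Module.length R (R ⧸ I) + 1 := by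
  rw [length_quotient_eq_add h, add_comm, ← Module.length_residue_eq_one (R := R)]
  gcongr
  let g : R ⧸ maximalIdeal R →ₗ[R] R ⧸ J :=
    Submodule.liftQ (maximalIdeal R) (LinearMap.toSpanSingleton R (R ⧸ J) (Submodule.Quotient.mk c))
      fun r hr ↦ by
        rw [LinearMap.mem_ker, LinearMap.toSpanSingleton_apply, ← Submodule.Quotient.mk_smul,
          Submodule.Quotient.mk_eq_zero]
        exact hc r hr
  suffices hg : LinearMap.ker (Submodule.factor h) ≤ LinearMap.range g from
    (Module.length_le_of_injective (Submodule.inclusion hg) (Submodule.inclusion_injective hg)).trans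
      (Module.length_le_of_surjective g.rangeRestrict g.surjective_rangeRestrict)
  intro z hz
  obtain ⟨a, rfl⟩ := Submodule.Quotient.mk_surjective J z
  have ha : a ∈ I := by
    rw [LinearMap.mem_ker] at hz
    exact (Submodule.Quotient.mk_eq_zero I).1 hz
  obtain ⟨u, hu⟩ := exists_sub_mul_mem (hI ha)
  refine ⟨Submodule.Quotient.mk u, ?_⟩
  rw [Submodule.liftQ_apply, LinearMap.toSpanSingleton_apply, ← Submodule.Quotient.mk_smul,
    eq_comm, Submodule.Quotient.eq, smul_eq_mul, mul_comm]
  exact hu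

theorem length_quotient_add_one_le {I J : Ideal R} (h : J < I) :
    Module.length R (R ⧸ I) + 1 ≤ Module.length R (R ⧸ J) := by
  rw [length_quotient_eq_add h.le, add_comm]
  gcongr
  rw [Order.one_le_iff_ne_zero, ← pos_iff_ne_zero, Module.length_pos_iff,
    Submodule.nontrivial_iff_ne_bot]
  intro hbot
  obtain ⟨a, ha, haJ⟩ := SetLike.exists_of_lt h
  refine haJ ((Submodule.Quotient.mk_eq_zero J).1 ?_)
  rw [← Submodule.mem_bot R, ← hbot, LinearMap.mem_ker]
  exact (Submodule.Quotient.mk_eq_zero I).2 ha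

theorem exists_mem_maximalIdeal_mul_mem {K K' : Ideal R} (h : K < K') {n : ℕ}
    (hn : maximalIdeal R ^ n ≤ K) :
    ∃ a ∈ K', a ∉ K ∧ ∀ r ∈ maximalIdeal R, r * a ∈ K := by
  classical
  -- With the least such exponent `k + 1`, any element of `𝔪^k K'` outside `K` is killed by `𝔪`
  -- modulo `K`.
  have hex : ∃ n, maximalIdeal R ^ n * K' ≤ K := ⟨n, Ideal.mul_le_left.trans hn⟩
  obtain ⟨k, hk⟩ : ∃ k, Nat.find hex = k + 1 := Nat.exists_eq_succ_of_ne_zero fun h0 ↦ by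
    have := Nat.find_spec hex
    rw [h0, pow_zero, Ideal.one_eq_top, Ideal.top_mul] at this
    exact h.not_ge this
  have h1 : ¬ maximalIdeal R ^ k * K' ≤ K := Nat.find_min hex (hk ▸ k.lt_succ_self)
  have h2 : maximalIdeal R ^ (k + 1) * K' ≤ K := hk ▸ Nat.find_spec hex
  obtain ⟨a, ha, haK⟩ := SetLike.not_le_iff_exists.1 h1
  refine ⟨a, Ideal.mul_le_right (I := maximalIdeal R ^ k) ha, haK, fun r hr ↦ h2 ?_⟩
  rw [pow_succ', mul_assoc]
  exact Ideal.mul_mem_mul hr ha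

/-- Multiplication by `a` maps `Q : K` into the socle of `R / Q` with kernel `Q : K'`, and the socle
has length at most one. -/
theorem HasSimpleSocle.length_colon_le {Q K K' : Ideal R} (hQ : HasSimpleSocle Q)
    (hKK' : K ≤ K') {a : R} (ha : ∀ r ∈ maximalIdeal R, r * a ∈ K)
    (hK' : K' = Ideal.span {a} ⊔ K) :
    Module.length R (R ⧸ Q.colon (K' : Set R)) ≤ Module.length R (R ⧸ Q.colon (K : Set R)) + 1 := by
  have hle : Q.colon (K' : Set R) ≤ Q.colon (K : Set R) := Submodule.colon_mono le_rfl hKK'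
  have hmem {c : R} (hc : c ∈ Q.colon (K : Set R)) (hca : c * a ∈ Q) :
      c ∈ Q.colon (K' : Set R) := by
    rw [Submodule.mem_colon] at hc ⊢
    intro s hs
    obtain ⟨u, hu⟩ := exists_sub_mul_mem (hK'.le hs)
    have := Q.add_mem (hc _ hu) (Q.mul_mem_left u hca)
    convert this using 1
    simp only [smul_eq_mul]
    ring
  by_cases h : Q.colon (K : Set R) ≤ Q.colon (K' : Set R)
  · rw [le_antisymm hle h]
    exact le_self_add
  · obtain ⟨c₀, hc₀, hc₀'⟩ := SetLike.not_le_iff_exists.1 h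
    have hsoc {c : R} (hc : c ∈ Q.colon (K : Set R)) : ∀ r ∈ maximalIdeal R, r * (c * a) ∈ Q := by
      intro r hr
      have := Submodule.mem_colon.1 hc _ (ha r hr)
      rwa [smul_eq_mul, mul_left_comm] at this
    refine length_quotient_le_add_one hle (c := c₀) (fun c hc ↦ ?_) fun r hr ↦ ?_
    · obtain ⟨u, hu⟩ := hQ _ _ (hsoc hc₀) (hsoc hc) fun h ↦ hc₀' (hmem hc₀ h)
      refine mem_span_singleton_sup_of_sub_mul_mem (c := u) (hmem ?_ ?_)
      · exact sub_mem hc (Ideal.mul_mem_right _ _ hc₀)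
      · convert hu using 1
        ring
    · refine hmem (Ideal.mul_mem_left _ _ hc₀) ?_
      rw [mul_assoc]
      exact hsoc hc₀ r hr

/-- Enlarging `K` by one socle element raises the colength of `Q : K` by at most one and lowers that
of `K` by at least one. -/
theorem HasSimpleSocle.length_add_length_le [IsNoetherianRing R] {Q : Ideal R}
    (hQ : HasSimpleSocle Q) {n : ℕ} (hn : maximalIdeal R ^ n ≤ Q) {K K' : Ideal R} (hQK : Q ≤ K)
    (hKK' : K ≤ K') :
    Module.length R (R ⧸ Q.colon (K' : Set R)) + Module.length R (R ⧸ K') ≤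
      Module.length R (R ⧸ Q.colon (K : Set R)) + Module.length R (R ⧸ K) := by
  induction K using WellFoundedGT.induction with
  | ind K ih =>
    obtain rfl | hlt := eq_or_lt_of_le hKK'
    · exact le_rfl
    obtain ⟨a, haK', haK, ha⟩ := exists_mem_maximalIdeal_mul_mem hlt (hn.trans hQK)
    have hK1 : K < Ideal.span {a} ⊔ K :=
      lt_of_le_of_ne le_sup_right fun h ↦ haK (h.ge (Ideal.mem_sup_left
        (Ideal.mem_span_singleton_self a)))
    refine (ih _ hK1 (hQK.trans hK1.le)
      (sup_le ((Ideal.span_singleton_le_iff_mem _).2 haK') hKK')).trans ?_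
    refine (add_le_add_left (hQ.length_colon_le hK1.le ha rfl) _).trans ?_
    rw [add_assoc, add_comm 1]
    gcongr
    exact length_quotient_add_one_le hK1

/-- This is `Q : (Q : K) = K`. If `K` and `K + (b)` had the same colon, the length inequality on `Q
≤ K` and on `K + (b) ≤ R` would force the finite length of `R / Q` to exceed itself. -/
theorem HasSimpleSocle.exists_mul_notMem [IsNoetherianRing R] {Q : Ideal R}
    (hQ : HasSimpleSocle Q) (hrad : Q.radical = maximalIdeal R) {K : Ideal R} (hQK : Q ≤ K)
    {b : R} (hb : b ∉ K) : ∃ c, (∀ k ∈ K, k * c ∈ Q) ∧ b * c ∉ Q := by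
  obtain ⟨n, hn⟩ := Ideal.exists_pow_le_of_le_radical_of_fg hrad.ge
    (IsNoetherian.noetherian (maximalIdeal R))
  by_contra! h
  have hlt : K < Ideal.span {b} ⊔ K :=
    lt_of_le_of_ne le_sup_right fun h ↦ hb (h.ge (Ideal.mem_sup_left
      (Ideal.mem_span_singleton_self b)))
  have hcolon : Q.colon (K : Set R) = Q.colon ((Ideal.span {b} ⊔ K : Ideal R) : Set R) := by
    refine le_antisymm (fun c hc ↦ ?_) (Submodule.colon_mono le_rfl hlt.le)
    rw [Submodule.mem_colon] at hc ⊢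
    intro s hs
    obtain ⟨u, hu⟩ := exists_sub_mul_mem hs
    have hbc := h c fun k hk ↦ by simpa [mul_comm] using hc k hk
    have := Q.add_mem (hc _ hu) (Q.mul_mem_left u hbc)
    convert this using 1
    simp only [smul_eq_mul]
    ring
  have h1 := hQ.length_add_length_le hn le_rfl hQK
  have h2 := hQ.length_add_length_le hn (hQK.trans hlt.le) le_top
  have h3 := length_quotient_add_one_le hlt
  have hQQ : Q.colon (Q : Set R) = ⊤ := by simp
  have hQtop : Q.colon ((⊤ : Ideal R) : Set R) = Q := by
    rw [Submodule.top_coe, Submodule.colon_univ]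
  have hsub (I : Ideal R) (hI : I = ⊤) : Module.length R (R ⧸ I) = 0 := by
    rw [Module.length_eq_zero_iff, hI]
    infer_instance
  rw [hQQ, hsub ⊤ rfl, zero_add] at h1
  rw [hQtop, hsub ⊤ rfl, add_zero, ← hcolon] at h2
  have hfin : Module.length R (R ⧸ Q) ≠ ⊤ := by
    have := isArtinianRing_quotient_of_radical_eq hrad
    have : IsArtinian R (R ⧸ Q) :=
      isArtinian_of_surjective_algebraMap (R := R ⧸ Q) Ideal.Quotient.mk_surjective
    exact Module.length_ne_top
  have h4 : Module.length R (R ⧸ Q) + 1 ≤ Module.length R (R ⧸ Q) :=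
    calc _ ≤ _ := add_le_add_left h2 1
      _ = Module.length R (R ⧸ Q.colon (K : Set R)) +
          (Module.length R (R ⧸ (Ideal.span {b} ⊔ K)) + 1) := add_assoc _ _ _
      _ ≤ _ := add_le_add_right h3 _
      _ ≤ _ := h1
  exact (ENat.lt_add_one_iff hfin |>.2 le_rfl).not_ge h4

end Duality

/-! ### Powers of systems of parameters -/

section PowerIdeals

variable {R : Type*} [CommRing R] {d : ℕ}

/-- The ideal generated by the `t`-th powers of the `x i`. -/
def powIdeal (x : Fin d → R) (t : ℕ) : Ideal R :=
  Ideal.span (Set.range fun i ↦ x i ^ t)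

theorem frobPower_powIdeal (p : ℕ) [ExpChar R p] (x : Fin d → R) (t e : ℕ) :
    frobPower p (powIdeal x t) e = powIdeal x (t * p ^ e) := by
  rw [powIdeal, frobPower_span, ← Set.range_comp]
  simp only [powIdeal, pow_mul]
  rfl

theorem map_powIdeal {S : Type*} [CommRing S] (φ : R →+* S) (x : Fin d → R) (t : ℕ) :
    (powIdeal x t).map φ = powIdeal (φ ∘ x) t := by
  rw [powIdeal, Ideal.map_span, ← Set.range_comp, powIdeal]
  congr 2
  ext i
  simp

theorem prod_pow_mul_mem_powIdeal (x : Fin d → R) {t : ℕ} {a : R} (ha : a ∈ powIdeal x t) (s : ℕ) :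
    a * (∏ i, x i) ^ s ∈ powIdeal x (t + s) := by
  suffices powIdeal x t ≤ (powIdeal x (t + s)).colon {(∏ i, x i) ^ s} from
    Submodule.mem_colon_singleton.1 (this ha)
  refine Ideal.span_le.2 ?_
  rintro _ ⟨i, rfl⟩
  rw [SetLike.mem_coe, Submodule.mem_colon_singleton, smul_eq_mul,
    ← Finset.mul_prod_erase _ _ (Finset.mem_univ i), mul_pow, ← mul_assoc, ← pow_add]
  exact Ideal.mul_mem_right _ _ (Ideal.subset_span ⟨i, rfl⟩)

theorem Ideal.ofList_ofFn (x : Fin d → R) :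
    Ideal.ofList (List.ofFn x) = Ideal.span (Set.range x) := by
  simp only [Ideal.ofList, List.mem_ofFn]
  rfl

variable [IsLocalRing R] {bs : List R} {x : Fin d → R}

theorem IsParameterList.append_ofFn_pow (h : IsParameterList (bs ++ List.ofFn x)) {e : Fin d → ℕ}
    (he : ∀ j, e j ≠ 0) : IsParameterList (bs ++ List.ofFn fun j ↦ x j ^ e j) := by
  refine ⟨by simpa using h.1, ?_⟩
  rw [← h.2]
  simp only [Ideal.ofList_append, Ideal.ofList_ofFn]
  refine le_antisymm (Ideal.radical_mono (sup_le_sup_left (Ideal.span_le.2 ?_) _))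
    (Ideal.radical_le_radical_iff.2 (sup_le (le_sup_left.trans Ideal.le_radical)
      (Ideal.span_le.2 ?_)))
  · rintro _ ⟨j, rfl⟩
    exact Ideal.pow_mem_of_mem (Ideal.span (Set.range x)) (Ideal.subset_span ⟨j, rfl⟩) _
      (Nat.pos_of_ne_zero (he j))
  · rintro _ ⟨j, rfl⟩
    exact ⟨e j, Ideal.mem_sup_right (Ideal.subset_span ⟨j, rfl⟩)⟩

theorem IsParameterList.radical_sup_powIdeal (h : IsParameterList (bs ++ List.ofFn x)) {t : ℕ}
    (ht : t ≠ 0) : (Ideal.ofList bs ⊔ powIdeal x t).radical = maximalIdeal R := by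
  have := (h.append_ofFn_pow (e := fun _ ↦ t) fun _ ↦ ht).2
  rwa [Ideal.ofList_append, Ideal.ofList_ofFn] at this

theorem IsParameterList.mem_of_mul_mem_erase {R : Type*} [CommRing R] [IsRegularLocalRing R]
    {bs : List R} {x : Fin d → R} (h : IsParameterList (bs ++ List.ofFn x)) (e : Fin d → ℕ)
    (i : Fin d) {a : R}
    (ha : x i * a ∈ Ideal.ofList bs ⊔ Ideal.span ((fun j ↦ x j ^ e j) '' {j | j ≠ i})) :
    a ∈ Ideal.ofList bs ⊔ Ideal.span ((fun j ↦ x j ^ e j) '' {j | j ≠ i}) := by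
  by_cases he : ∃ j, j ≠ i ∧ e j = 0
  · obtain ⟨j, hji, hj⟩ := he
    have h1 : (1 : R) ∈ Ideal.span ((fun j ↦ x j ^ e j) '' {j | j ≠ i}) :=
      Ideal.subset_span ⟨j, hji, by simp [hj]⟩
    rw [(Ideal.eq_top_iff_one _).2 h1, sup_top_eq]
    trivial
  push Not at he
  classical
  let rs := bs ++ ((Finset.univ.erase i).toList.map fun j ↦ x j ^ e j)
  have hrs : Ideal.ofList rs =
      Ideal.ofList bs ⊔ Ideal.span ((fun j ↦ x j ^ e j) '' {j | j ≠ i}) := by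
    simp only [rs, Ideal.ofList_append, Ideal.ofList]
    congr 2
    ext r
    simp
  have hpar : IsParameterList (x i :: rs) := by
    have h' := h.append_ofFn_pow (e := Function.update e i 1) fun j ↦ by
      by_cases hj : j = i
      · subst hj; simp
      · simpa [hj] using he j hj
    have hd : d ≠ 0 := fun hd ↦ by subst hd; exact i.elim0
    refine ⟨by rw [h.1]; simp [rs]; norm_cast; omega, ?_⟩
    rw [← h'.2, Ideal.ofList_cons, hrs, Ideal.ofList_append, Ideal.ofList_ofFn, sup_left_comm]
    congr 2
    rw [← Ideal.span_union]
    congr 1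
    ext r
    simp only [Set.singleton_union, Set.mem_insert_iff, Set.mem_image, Set.mem_range]
    constructor
    · rintro (rfl | ⟨j, hj, rfl⟩)
      · exact ⟨i, by simp⟩
      · exact ⟨j, by rw [Function.update_of_ne hj]⟩
    · rintro ⟨j, rfl⟩
      by_cases hj : j = i
      · subst hj; simp
      · exact Or.inr ⟨j, hj, by rw [Function.update_of_ne hj]⟩
  rw [← hrs] at ha ⊢
  exact hpar.mem_of_mul_mem ha

/-- The factors `x i ^ s` are cancelled one index at a time, each cancellation lowering one exponent
in the ideal from `t + s` to `t`. -/
theorem IsParameterList.mem_of_mul_prod_pow_mem {R : Type*} [CommRing R] [IsRegularLocalRing R]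
    {bs : List R} {x : Fin d → R} (h : IsParameterList (bs ++ List.ofFn x)) {t s : ℕ} {a : R}
    (ha : a * (∏ i, x i) ^ s ∈ Ideal.ofList bs ⊔ powIdeal x (t + s)) :
    a ∈ Ideal.ofList bs ⊔ powIdeal x t := by
  classical
  suffices key : ∀ (T : Finset (Fin d)) (a : R), a * ∏ j ∈ T, x j ^ s ∈ Ideal.ofList bs ⊔
      Ideal.span (Set.range fun j ↦ x j ^ (t + if j ∈ T then s else 0)) →
      a ∈ Ideal.ofList bs ⊔ powIdeal x t by
    refine key Finset.univ a ?_
    simpa [powIdeal, Finset.prod_pow] using ha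
  intro T
  induction T using Finset.induction_on with
  | empty => intro a ha; simpa [powIdeal] using ha
  | insert i T hi ih =>
    intro a ha
    refine ih a ?_
    set e : Fin d → ℕ := fun j ↦ t + if j ∈ T then s else 0 with he
    set I := Ideal.ofList bs ⊔ Ideal.span ((fun j ↦ x j ^ e j) '' {j | j ≠ i}) with hI
    have hpow (k : ℕ) (b : R) (hb : x i ^ k * b ∈ I) : b ∈ I := by
      induction k with
      | zero => simpa using hb
      | succ k ihk =>
        exact ihk (h.mem_of_mul_mem_erase e i (by rwa [← mul_assoc, ← pow_succ']))
    have hle : I ≤ Ideal.ofList bs ⊔ Ideal.span (Set.range fun j ↦ x j ^ e j) :=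
      sup_le_sup_left (Ideal.span_mono (Set.image_subset_range _ _)) _
    have hmem : a * ∏ j ∈ insert i T, x j ^ s ∈ Ideal.span {x i ^ (t + s)} ⊔ I := by
      refine SetLike.le_def.1 ?_ ha
      rw [hI, sup_left_comm]
      refine sup_le_sup_left (Ideal.span_le.2 ?_) _
      rintro _ ⟨j, rfl⟩
      by_cases hj : j = i
      · subst hj
        exact Ideal.mem_sup_left (by simp)
      · exact Ideal.mem_sup_right (Ideal.subset_span ⟨j, hj, by simp [he, hj]⟩)
    obtain ⟨c, hc⟩ := exists_sub_mul_mem hmem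
    have hc' : a * ∏ j ∈ T, x j ^ s - x i ^ t * c ∈ I := by
      refine hpow s _ ?_
      convert hc using 1
      rw [Finset.prod_insert hi, pow_add]
      ring
    rw [← sub_add_cancel (a * ∏ j ∈ T, x j ^ s) (x i ^ t * c)]
    refine add_mem (hle hc') (Ideal.mul_mem_right _ _ (Ideal.mem_sup_right ?_))
    exact Ideal.subset_span ⟨i, by simp [hi]⟩

/-- Krull's theorem in `R / I` reduces to an Artinian quotient by parameter powers, where the
double-colon duality supplies `a`. -/
theorem IsParameterList.exists_separating {R : Type*} [CommRing R] [IsRegularLocalRing R]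
    {bs : List R} {x : Fin d → R} (h : IsParameterList (bs ++ List.ofFn x)) {I : Ideal R}
    (hI : Ideal.ofList bs ≤ I) {b : R} (hb : b ∉ I) :
    ∃ t a, (∀ c ∈ I, c * a ∈ Ideal.ofList bs ⊔ powIdeal x t) ∧
      b * a ∉ Ideal.ofList bs ⊔ powIdeal x t := by
  obtain ⟨t, ht⟩ : ∃ t, b ∉ I ⊔ maximalIdeal R ^ t := by
    by_contra! hall
    refine hb (Ideal.Quotient.eq_zero_iff_mem.1 ?_)
    have hbot := Ideal.iInf_pow_smul_eq_bot_of_isLocalRing (M := R ⧸ I) (maximalIdeal R)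
      (maximalIdeal.isMaximal R).ne_top
    rw [← Submodule.mem_bot R, ← hbot, Submodule.mem_iInf]
    intro k
    obtain ⟨i, hi, c, hc, rfl⟩ := Submodule.mem_sup.1 (hall k)
    have : Ideal.Quotient.mk I (i + c) = c • (1 : R ⧸ I) := by
      rw [map_add, Ideal.Quotient.eq_zero_iff_mem.2 hi, zero_add, Algebra.smul_def, mul_one]
      rfl
    rw [this]
    exact Submodule.smul_mem_smul hc trivial
  -- The shift to `t + 1` keeps the exponent nonzero, so the powers remain parameters.
  have hle : powIdeal x (t + 1) ≤ maximalIdeal R ^ t := by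
    refine Ideal.span_le.2 ?_
    rintro _ ⟨i, rfl⟩
    refine Ideal.pow_le_pow_right t.le_succ (Ideal.pow_mem_pow (h.mem ?_) _)
    exact List.mem_append_right _ (List.mem_ofFn.2 ⟨i, rfl⟩)
  have hsoc := (h.append_ofFn_pow (e := fun _ ↦ t + 1) fun _ ↦ t.succ_ne_zero).hasSimpleSocle
  rw [Ideal.ofList_append, Ideal.ofList_ofFn] at hsoc
  obtain ⟨c, hc, hbc⟩ := hsoc.exists_mul_notMem (K := I ⊔ powIdeal x (t + 1))
    (h.radical_sup_powIdeal t.succ_ne_zero) (sup_le_sup_right hI _)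
    fun hmem ↦ ht (sup_le_sup_left hle I hmem)
  exact ⟨t + 1, c, fun k hk ↦ hc k (Ideal.mem_sup_left hk), hbc⟩

end PowerIdeals

/-! ### Vanishing of classes in top local cohomology -/

section Cech

variable {S : Type*} [CommRing S] {d : ℕ}

/-- `z` is represented by the fraction `a / (∏ i, x i) ^ t`. -/
def IsFraction (x : Fin d → S) (z : Localization.Away (∏ i, x i)) (t : ℕ) (a : S) : Prop :=
  z * algebraMap S (Localization.Away (∏ i, x i)) ((∏ i, x i) ^ t) =
    algebraMap S (Localization.Away (∏ i, x i)) a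

theorem exists_isFraction (x : Fin d → S) (z : Localization.Away (∏ i, x i)) :
    ∃ t a, IsFraction x z t a := by
  obtain ⟨⟨a, ⟨_, t, rfl⟩⟩, h⟩ := IsLocalization.surj (Submonoid.powers (∏ i, x i)) z
  exact ⟨t, a, h⟩

theorem exists_isFraction_of (x : Fin d → S) (t : ℕ) (a : S) : ∃ z, IsFraction x z t a :=
  ⟨IsLocalization.mk' _ a (⟨_, t, rfl⟩ : Submonoid.powers (∏ i, x i)),
    IsLocalization.mk'_spec _ a (⟨_, t, rfl⟩ : Submonoid.powers (∏ i, x i))⟩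

theorem isUnit_algebraMap_prod_pow (x : Fin d → S) (t : ℕ) :
    IsUnit (algebraMap S (Localization.Away (∏ i, x i)) ((∏ i, x i) ^ t)) :=
  IsLocalization.map_units _ (⟨_, t, rfl⟩ : Submonoid.powers (∏ i, x i))

variable {x : Fin d → S}

theorem IsFraction.mul_pow {z : Localization.Away (∏ i, x i)} {t : ℕ} {a : S}
    (h : IsFraction x z t a) (s : ℕ) : IsFraction x z (t + s) (a * (∏ i, x i) ^ s) := by
  rw [IsFraction, pow_add, map_mul, ← mul_assoc, h, map_mul]

theorem exists_isFraction_of_mem_cechBoundary {z : Localization.Away (∏ i, x i)}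
    (hz : z ∈ cechBoundary x) : ∃ t, ∃ a ∈ powIdeal x t, IsFraction x z t a := by
  induction hz using Submodule.span_induction with
  | mem z hz =>
    obtain ⟨i, t, a, h⟩ := hz
    refine ⟨t, a * x i ^ t, Ideal.mul_mem_left _ _ (Ideal.subset_span ⟨i, rfl⟩), ?_⟩
    have hprod : (∏ i, x i) ^ t = (∏ j ∈ Finset.univ.erase i, x j) ^ t * x i ^ t := by
      rw [← mul_pow, Finset.prod_erase_mul _ _ (Finset.mem_univ i)]
    rw [IsFraction, hprod, map_mul, map_mul, ← h, ← mul_assoc]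
  | zero => exact ⟨0, 0, zero_mem _, by simp [IsFraction]⟩
  | add y z _ _ hy hz =>
    obtain ⟨t, a, ha, h⟩ := hy
    obtain ⟨s, b, hb, h'⟩ := hz
    refine ⟨t + s, _, add_mem (prod_pow_mul_mem_powIdeal x ha s)
      (add_comm s t ▸ prod_pow_mul_mem_powIdeal x hb t), ?_⟩
    have h1 := h.mul_pow s
    have h2 := h'.mul_pow t
    rw [add_comm s t] at h2
    rw [IsFraction, add_mul, h1, h2, map_add]
  | smul c z _ hz =>
    obtain ⟨t, a, ha, h⟩ := hz
    refine ⟨t, c * a, Ideal.mul_mem_left _ _ ha, ?_⟩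
    rw [IsFraction, smul_mul_assoc, h, Algebra.smul_def, map_mul]

theorem mem_cechBoundary_of_isFraction {z : Localization.Away (∏ i, x i)} {t : ℕ} {a : S}
    (ha : a ∈ powIdeal x t) (h : IsFraction x z t a) : z ∈ cechBoundary x := by
  obtain ⟨w, hw⟩ := exists_isFraction_of x t 1
  have hz : z = a • w := by
    refine (isUnit_algebraMap_prod_pow x t).mul_left_injective ?_
    simp only
    rw [smul_mul_assoc, hw, h, Algebra.smul_def, map_one, mul_one]
  rw [hz]
  suffices powIdeal x t ≤ (cechBoundary x).comap (LinearMap.toSpanSingleton S _ w) from this ha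
  refine Ideal.span_le.2 ?_
  rintro _ ⟨i, rfl⟩
  refine Submodule.subset_span ⟨i, t, 1, ?_⟩
  rw [LinearMap.toSpanSingleton_apply, Algebra.smul_def, mul_right_comm, ← map_mul, ← mul_pow,
    Finset.mul_prod_erase _ _ (Finset.mem_univ i), mul_comm]
  exact hw

/-- Multiplication by `∏ i, x i` induces injections between the quotients by the ideals
generated by powers of the `x i`; for a system of parameters this is the Cohen–Macaulay
property. -/
def HasInjectiveTransition (x : Fin d → S) : Prop :=
  ∀ (t s : ℕ) (a : S), a * (∏ i, x i) ^ s ∈ powIdeal x (t + s) → a ∈ powIdeal x t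

theorem mem_cechBoundary_iff (hx : HasInjectiveTransition x) {z : Localization.Away (∏ i, x i)}
    {t : ℕ} {a : S} (h : IsFraction x z t a) : z ∈ cechBoundary x ↔ a ∈ powIdeal x t := by
  refine ⟨fun hz ↦ ?_, fun ha ↦ mem_cechBoundary_of_isFraction ha h⟩
  obtain ⟨t', a', ha', h'⟩ := exists_isFraction_of_mem_cechBoundary hz
  have h1 := h.mul_pow t'
  have h2 := h'.mul_pow t
  rw [add_comm t' t] at h2
  obtain ⟨⟨_, s, rfl⟩, hs⟩ := (IsLocalization.eq_iff_exists (Submonoid.powers (∏ i, x i)) _).1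
    (h1.symm.trans h2)
  refine hx t (t' + s) a ?_
  simp only at hs
  have hs' : a * (∏ i, x i) ^ (t' + s) = a' * (∏ i, x i) ^ (t + s) := by
    linear_combination hs
  rw [hs', add_left_comm]
  exact prod_pow_mul_mem_powIdeal x ha' (t + s)

variable {p : ℕ} [ExpChar S p]

theorem IsFraction.smul_frobeniusAway {z : Localization.Away (∏ i, x i)} {t : ℕ} {a : S}
    (h : IsFraction x z t a) (u : S) :
    IsFraction x (u • frobeniusAway p (∏ i, x i) z) (t * p) (u * a ^ p) := by
  rw [IsFraction, pow_mul, ← frobeniusAway_algebraMap, smul_mul_assoc, ← frobeniusAway_mul, h,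
    frobeniusAway_algebraMap, Algebra.smul_def, map_mul]

/-- The sequence `v` collects the factors of `u`, namely `u^(1 + p + ⋯ + p^(i-1))`. The recursion
serves both actions, with `v i = f^(p^i - 1)` and with `v i = 1`. -/
theorem exists_iterate_smul_frobeniusAction_eq {z : Localization.Away (∏ i, x i)} {t : ℕ} {a : S}
    (h : IsFraction x z t a) {u : S} {v : ℕ → S} (h0 : v 0 = 1)
    (hv : ∀ i, v (i + 1) = u * v i ^ p) (i : ℕ) :
    ∃ w, (u • frobeniusAction p x)^[i] (Submodule.Quotient.mk z) = Submodule.Quotient.mk w ∧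
      IsFraction x w (t * p ^ i) (v i * a ^ p ^ i) := by
  induction i with
  | zero => exact ⟨z, rfl, by simpa [h0] using h⟩
  | succ i ih =>
    obtain ⟨w, hw, hfrac⟩ := ih
    refine ⟨u • frobeniusAway p (∏ i, x i) w, ?_, ?_⟩
    · rw [Function.iterate_succ_apply', hw]
      rfl
    · have := hfrac.smul_frobeniusAway (p := p) u
      rw [mul_pow, ← mul_assoc, ← hv, ← pow_mul, mul_assoc, ← pow_succ] at this
      exact this

theorem mem_nilKernel_iff (hx : HasInjectiveTransition x) {z : Localization.Away (∏ i, x i)}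
    {t : ℕ} {a : S} (h : IsFraction x z t a) {u : S} {v : ℕ → S} (h0 : v 0 = 1)
    (hv : ∀ i, v (i + 1) = u * v i ^ p) (i : ℕ) :
    (Submodule.Quotient.mk z : TopLocalCohomology x) ∈ nilKernel (u • frobeniusAction p x) i ↔
      v i * a ^ p ^ i ∈ powIdeal x (t * p ^ i) := by
  obtain ⟨w, hw, hfrac⟩ := exists_iterate_smul_frobeniusAction_eq h h0 hv i
  rw [nilKernel, Set.mem_ofPred_eq, hw, Submodule.Quotient.mk_eq_zero, mem_cechBoundary_iff hx hfrac]

theorem nilKernel_eq_iff (hx : HasInjectiveTransition x) {u : S} {v : ℕ → S} (h0 : v 0 = 1)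
    (hv : ∀ i, v (i + 1) = u * v i ^ p) (l m : ℕ) :
    nilKernel (u • frobeniusAction p x) l = nilKernel (u • frobeniusAction p x) m ↔
      ∀ t a, v l * a ^ p ^ l ∈ powIdeal x (t * p ^ l) ↔
        v m * a ^ p ^ m ∈ powIdeal x (t * p ^ m) := by
  constructor
  · intro h t a
    obtain ⟨z, hz⟩ := exists_isFraction_of x t a
    rw [← mem_nilKernel_iff hx hz h0 hv, ← mem_nilKernel_iff hx hz h0 hv, h]
  · intro h
    ext z
    obtain ⟨z, rfl⟩ := Submodule.Quotient.mk_surjective _ z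
    obtain ⟨t, a, hz⟩ := exists_isFraction x z
    rw [mem_nilKernel_iff hx hz h0 hv, mem_nilKernel_iff hx hz h0 hv]
    exact h t a

end Cech

/-! ### HSL numbers -/

section HSL

theorem isParameterList_ofFn {R : Type*} [CommRing R] [IsLocalRing R] {n : ℕ} {x : Fin n → R}
    (h : IsSystemOfParameters x) : IsParameterList ([] ++ List.ofFn x) :=
  ⟨by simpa using h.1, by rw [List.nil_append, Ideal.ofList_ofFn, h.2]⟩

/-- Lifted parameters together with `f` are parameters of `R`, because `f` is a nonzerodivisor.
Computations in `R / (f)` thus move to the regular ring. -/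
theorem isParameterList_cons_ofFn {R : Type*} [CommRing R] [IsRegularLocalRing R] {f : R}
    (hf : f ≠ 0) (hm : f ∈ maximalIdeal R) [IsLocalRing (R ⧸ Ideal.span {f})] {d : ℕ}
    {x : Fin d → R} (h : IsSystemOfParameters (Ideal.Quotient.mk (Ideal.span {f}) ∘ x)) :
    IsParameterList ([f] ++ List.ofFn x) := by
  have := IsRegularLocalRing.isDomain R
  refine ⟨?_, ?_⟩
  · rw [← ringKrullDim_quotient_span_singleton_succ_eq_ringKrullDim_of_mem_nonZeroDivisors
      (mem_nonZeroDivisors_of_ne_zero hf) hm, h.1]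
    simp
  · have hmap : Ideal.span (Set.range (Ideal.Quotient.mk (Ideal.span {f}) ∘ x)) =
        (Ideal.span (Set.range x)).map (Ideal.Quotient.mk (Ideal.span {f})) := by
      rw [Ideal.map_span, Set.range_comp]
    have hcomap := congrArg (Ideal.comap (Ideal.Quotient.mk (Ideal.span {f}))) h.2
    rw [hmap, Ideal.comap_radical, Ideal.comap_map_of_surjective' _ Ideal.Quotient.mk_surjective,
      Ideal.mk_ker, sup_comm] at hcomap
    rw [Ideal.ofList_append, Ideal.ofList_ofFn, Ideal.ofList_singleton, hcomap]
    have := Ideal.comap_isMaximal_of_surjective _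
      (Ideal.Quotient.mk_surjective (I := Ideal.span {f}))
      (K := maximalIdeal (R ⧸ Ideal.span {f}))
    exact IsLocalRing.eq_maximalIdeal this

theorem hslIdeal_eq_iff {R : Type*} [CommRing R] [IsRegularLocalRing R] {p : ℕ} {f : R}
    {bs : List R} {d : ℕ} {x : Fin d → R} (h : IsParameterList (bs ++ List.ofFn x)) {l m : ℕ}
    (hl : Ideal.ofList bs ≤ hslIdeal p f l) (hm : Ideal.ofList bs ≤ hslIdeal p f m) :
    (∀ t a, (∀ c ∈ hslIdeal p f l, c * a ∈ Ideal.ofList bs ⊔ powIdeal x t) ↔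
      ∀ c ∈ hslIdeal p f m, c * a ∈ Ideal.ofList bs ⊔ powIdeal x t) ↔
      hslIdeal p f l = hslIdeal p f m := by
  refine ⟨fun H ↦ le_antisymm (fun b hb ↦ ?_) (fun b hb ↦ ?_), fun H t a ↦ by rw [H]⟩
  · by_contra hbm
    obtain ⟨t, a, ha, hba⟩ := h.exists_separating hm hbm
    exact hba ((H t a).2 ha b hb)
  · by_contra hbl
    obtain ⟨t, a, ha, hba⟩ := h.exists_separating hl hbl
    exact hba ((H t a).1 ha b hb)

variable {R : Type*} [CommRing R] [IsRegularLocalRing R] {p : ℕ} [Fact p.Prime] [CharP R p]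

theorem nilKernel_smul_frobeniusAction_eq_iff (H : HasFrobeniusCoordinates R p) (f : R) {n : ℕ}
    {x : Fin n → R} (hx : IsSystemOfParameters x) (l m : ℕ) :
    nilKernel (f ^ (p - 1) • frobeniusAction p x) l =
        nilKernel (f ^ (p - 1) • frobeniusAction p x) m ↔
      hslIdeal p f l = hslIdeal p f m := by
  have hpar := isParameterList_ofFn hx
  have hp := (Fact.out : p.Prime).pos
  have hinj : HasInjectiveTransition x := fun t s a ha ↦ by
    have := hpar.mem_of_mul_prod_pow_mem (t := t) (s := s) (a := a) (by simpa using ha)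
    simpa using this
  have hv (i : ℕ) : f ^ (p ^ (i + 1) - 1) = f ^ (p - 1) * (f ^ (p ^ i - 1)) ^ p := by
    rw [← pow_mul, ← pow_add]
    congr 1
    have h1 := Nat.one_le_pow i p hp
    have h2 : p ≤ p ^ i * p := Nat.le_mul_of_pos_left p h1
    rw [pow_succ, Nat.sub_mul, one_mul]
    omega
  rw [nilKernel_eq_iff hinj (v := fun i ↦ f ^ (p ^ i - 1)) (by simp) hv,
    ← hslIdeal_eq_iff hpar (by simp) (by simp)]
  refine forall₂_congr fun t a ↦ ?_
  have key (i : ℕ) : f ^ (p ^ i - 1) * a ^ p ^ i ∈ powIdeal x (t * p ^ i) ↔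
      ∀ c ∈ hslIdeal p f i, c * a ∈ Ideal.ofList [] ⊔ powIdeal x t := by
    rw [← frobPower_powIdeal, mul_pow_mem_frobPower_iff H, Ideal.ofList_nil, bot_sup_eq]
    rfl
  rw [key, key]

theorem mk_mem_powIdeal_iff {R : Type*} [CommRing R] (J : Ideal R) {d : ℕ} (x : Fin d → R) (t : ℕ)
    (a : R) : Ideal.Quotient.mk J a ∈ powIdeal (Ideal.Quotient.mk J ∘ x) t ↔
      a ∈ J ⊔ powIdeal x t := by
  rw [← map_powIdeal, ← Ideal.mem_comap,
    Ideal.comap_map_of_surjective' _ Ideal.Quotient.mk_surjective, Ideal.mk_ker, sup_comm]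

/-- Modulo `f`, a `p ^ e`-th power lies in a bracket power if and only if its multiple by
`f ^ (p ^ e - 1)` does so in the ambient ring. -/
theorem pow_mem_span_sup_powIdeal_iff {f : R} {d : ℕ} {x : Fin d → R}
    (h : IsParameterList ([f] ++ List.ofFn x)) (t e : ℕ) (a : R) :
    a ^ p ^ e ∈ Ideal.span {f} ⊔ powIdeal x (t * p ^ e) ↔
      f ^ (p ^ e - 1) * a ^ p ^ e ∈ frobPower p (Ideal.span {f} ⊔ powIdeal x t) e := by
  have hpos : 0 < p ^ e := pow_pos (Fact.out : p.Prime).pos e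
  have hpow : f ^ p ^ e = f ^ (p ^ e - 1) * f := by rw [← pow_succ, Nat.sub_add_cancel hpos]
  have hfrob : frobPower p (Ideal.span {f} ⊔ powIdeal x t) e =
      Ideal.span {f ^ p ^ e} ⊔ powIdeal x (t * p ^ e) := by
    rw [← frobPower_span_singleton, ← frobPower_powIdeal, frobPower_eq_map, Ideal.map_sup,
      frobPower_eq_map, frobPower_eq_map]
  rw [hfrob]
  have hreg (k : ℕ) (b : R) (hb : f ^ k * b ∈ powIdeal x (t * p ^ e)) :
      b ∈ powIdeal x (t * p ^ e) := by
    -- Exponent zero gives the unit ideal, except when there are no `x i`. Then the ideal is zero,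
    -- and `f ≠ 0` because the dimension is one.
    obtain h0 | h0 := eq_or_ne (t * p ^ e) 0
    · obtain hd | ⟨⟨i⟩⟩ := isEmpty_or_nonempty (Fin d)
      · have hbot : powIdeal x (t * p ^ e) = ⊥ := by simp [powIdeal]
        rw [hbot, Ideal.mem_bot] at hb ⊢
        have := IsRegularLocalRing.isDomain R
        refine (mul_eq_zero.1 hb).resolve_left (pow_ne_zero k ?_)
        rintro rfl
        have hd := h.1
        have hz := h.2
        rw [Ideal.ofList_append, Ideal.ofList_ofFn] at hz
        simp only [Set.range_eq_empty, Ideal.span_empty, Ideal.ofList_singleton,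
          Ideal.span_singleton_zero, bot_sup_eq] at hz
        have hzero : maximalIdeal R = ⊥ := by rw [← hz]; exact (Ideal.isRadical_bot).radical
        have hfield := isField_iff_maximalIdeal_eq.2 hzero
        rw [ringKrullDim_eq_zero_of_isField hfield] at hd
        have : 0 = ([0] ++ List.ofFn x).length := by exact_mod_cast hd
        simp at this
      · have : (1 : R) ∈ powIdeal x (t * p ^ e) := Ideal.subset_span ⟨i, by simp [h0]⟩
        rw [(Ideal.eq_top_iff_one _).2 this]
        trivial
    · have hpar := h.append_ofFn_pow (e := fun _ ↦ t * p ^ e) fun _ ↦ h0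
      have heq : powIdeal x (t * p ^ e) = Ideal.ofList (List.ofFn fun j ↦ x j ^ (t * p ^ e)) :=
        (Ideal.ofList_ofFn _).symm
      induction k with
      | zero => simpa using hb
      | succ k ih =>
        refine ih ?_
        rw [heq] at hb ⊢
        exact IsParameterList.mem_of_mul_mem hpar (by rwa [← mul_assoc, ← pow_succ'])
  constructor
  · intro ha
    obtain ⟨c, hc⟩ := exists_sub_mul_mem ha
    refine mem_span_singleton_sup_of_sub_mul_mem (c := c) ?_
    have := Ideal.mul_mem_left _ (f ^ (p ^ e - 1)) hc
    rw [hpow]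
    convert this using 1
    ring
  · intro ha
    obtain ⟨c, hc⟩ := exists_sub_mul_mem ha
    refine mem_span_singleton_sup_of_sub_mul_mem (c := c) (hreg (p ^ e - 1) _ ?_)
    rw [hpow] at hc
    convert hc using 1
    ring

theorem nilKernel_frobeniusAction_quotient_eq_iff (H : HasFrobeniusCoordinates R p) {f : R}
    (hf : f ≠ 0) (hm : f ∈ maximalIdeal R) [IsLocalRing (R ⧸ Ideal.span {f})]
    [CharP (R ⧸ Ideal.span {f}) p] {d : ℕ} {y : Fin d → R ⧸ Ideal.span {f}}
    (hy : IsSystemOfParameters y) (l m : ℕ) :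
    nilKernel (frobeniusAction p y) l = nilKernel (frobeniusAction p y) m ↔
      hslIdeal p f l = hslIdeal p f m := by
  obtain ⟨x, rfl⟩ : ∃ x : Fin d → R, Ideal.Quotient.mk (Ideal.span {f}) ∘ x = y :=
    ⟨fun i ↦ Function.surjInv Ideal.Quotient.mk_surjective (y i),
      funext fun i ↦ Function.surjInv_eq Ideal.Quotient.mk_surjective (y i)⟩
  have hpar := isParameterList_cons_ofFn hf hm hy
  have hofList : Ideal.ofList [f] = Ideal.span {f} := Ideal.ofList_singleton f
  have hinj : HasInjectiveTransition (Ideal.Quotient.mk (Ideal.span {f}) ∘ x) := fun t s a ha ↦ by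
    obtain ⟨a, rfl⟩ := Ideal.Quotient.mk_surjective a
    have hprod : ∏ i, (Ideal.Quotient.mk (Ideal.span {f}) ∘ x) i =
        Ideal.Quotient.mk (Ideal.span {f}) (∏ i, x i) := (map_prod _ _ _).symm
    rw [hprod, ← map_pow, ← map_mul, mk_mem_powIdeal_iff] at ha
    rw [mk_mem_powIdeal_iff, ← hofList]
    exact hpar.mem_of_mul_prod_pow_mem (hofList ▸ ha)
  have hle (i : ℕ) : Ideal.ofList [f] ≤ hslIdeal p f i := by
    rw [hofList, Ideal.span_singleton_le_iff_mem]
    exact mem_hslIdeal H f i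
  -- The plain Frobenius action is the twisted one with `u = 1`, so the same criterion applies.
  rw [← one_smul (R ⧸ Ideal.span {f}) (frobeniusAction p _),
    nilKernel_eq_iff hinj (v := fun _ ↦ 1) rfl (by simp), ← hslIdeal_eq_iff hpar (hle l) (hle m)]
  refine forall_congr' fun t ↦ Ideal.Quotient.mk_surjective.forall.trans (forall_congr' fun a ↦ ?_)
  have key (i : ℕ) : 1 * Ideal.Quotient.mk (Ideal.span {f}) a ^ p ^ i ∈
      powIdeal (Ideal.Quotient.mk (Ideal.span {f}) ∘ x) (t * p ^ i) ↔
      ∀ c ∈ hslIdeal p f i, c * a ∈ Ideal.ofList [f] ⊔ powIdeal x t := by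
    rw [one_mul, ← map_pow, mk_mem_powIdeal_iff, pow_mem_span_sup_powIdeal_iff hpar,
      mul_pow_mem_frobPower_iff H, hofList]
    rfl
  rw [key, key]

theorem exists_isLeast_hslIdeal (H : HasFrobeniusCoordinates R p) (f : R) :
    ∃ ℓ, IsLeast {l : ℕ | 1 ≤ l ∧ ∀ i, 1 ≤ i → hslIdeal p f l = hslIdeal p f (l + i)} ℓ := by
  classical
  obtain ⟨e, he⟩ := exists_hslIdeal_eq_succ H f
  have hex : ∃ l, 1 ≤ l ∧ ∀ i, 1 ≤ i → hslIdeal p f l = hslIdeal p f (l + i) :=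
    -- The equality may occur at `e = 0`, whereas the index sought must be positive.
    ⟨e + 1, e.succ_pos, fun i _ ↦ by
      rw [← he, add_assoc]
      exact hslIdeal_stable H f he (1 + i)⟩
  exact ⟨Nat.find hex, Nat.find_spec hex, fun l hl ↦ Nat.find_min' hex hl⟩

end HSL

end

/-- For a regular `F`-finite local ring `R` of characteristic `p` and a nonzero `f`, the HSL number
of `(E_R, f ^ (p - 1) F)` and (when `f` lies in the maximal ideal, so that `R / (f)` is a local
ring) that of `(E_{R/(f)}, Θ)` exist and both equal the least `ℓ ≥ 1` with
`τ(f^{1 - 1/p^ℓ}) = τ(f^{1 - 1/p^(ℓ + i)})` for all `i ≥ 1`, which is the least `ℓ ≥ 1` such that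
`f` has no `F`-jumping number in `(1 - 1/p^ℓ, 1)`; the last two conditions on `ℓ` are
equivalent for every `ℓ ≥ 1`. -/
theorem corollary5p8 {R : Type*} [CommRing R] [IsRegularLocalRing R] (p : ℕ) [Fact p.Prime]
    [CharP R p] (hF : IsFFinite R p) (f : R) (hf : f ≠ 0) :
    (∃ ℓ : ℕ,
      IsLeast {l : ℕ | 1 ≤ l ∧ ∀ i : ℕ, 1 ≤ i →
        testIdeal p (Ideal.span {f}) (1 - 1 / (p : ℝ) ^ l) =
          testIdeal p (Ideal.span {f}) (1 - 1 / (p : ℝ) ^ (l + i))} ℓ ∧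
      IsLeast {l : ℕ | 1 ≤ l ∧ ∀ lam ∈ Set.Ioo (1 - 1 / (p : ℝ) ^ l) 1,
        ¬ IsFJumpingNumber p (Ideal.span {f}) lam} ℓ ∧
      (∀ {n : ℕ} (x : Fin n → R), IsSystemOfParameters x →
        IsHSLNumber (f ^ (p - 1) • frobeniusAction p x) ℓ) ∧
      (∀ hm : f ∈ maximalIdeal R,
        haveI := isLocalRing_quotient_span hm
        haveI := charP_quotient_span p hm
        ∀ {d : ℕ} (y : Fin d → R ⧸ Ideal.span {f}), IsSystemOfParameters y →
          IsHSLNumber (frobeniusAction p y) ℓ)) ∧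
    ∀ l : ℕ, 1 ≤ l →
      ((∀ i : ℕ, 1 ≤ i →
        testIdeal p (Ideal.span {f}) (1 - 1 / (p : ℝ) ^ l) =
          testIdeal p (Ideal.span {f}) (1 - 1 / (p : ℝ) ^ (l + i))) ↔
      ∀ lam ∈ Set.Ioo (1 - 1 / (p : ℝ) ^ l) 1,
        ¬ IsFJumpingNumber p (Ideal.span {f}) lam) := by

  have H := hF.hasFrobeniusCoordinates
  have hτ (l : ℕ) (hl : 1 ≤ l) : (∀ i : ℕ, 1 ≤ i →
        testIdeal p (Ideal.span {f}) (1 - 1 / (p : ℝ) ^ l) =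
          testIdeal p (Ideal.span {f}) (1 - 1 / (p : ℝ) ^ (l + i))) ↔
      ∀ i : ℕ, 1 ≤ i → hslIdeal p f l = hslIdeal p f (l + i) := by
    refine forall₂_congr fun i _ ↦ ?_
    rw [testIdeal_one_sub H f hl, testIdeal_one_sub H f (hl.trans (Nat.le_add_right l i))]
  have hjump (l : ℕ) := testIdeal_stable_iff_forall_not_isFJumpingNumber H hf (l := l)
  obtain ⟨ℓ, hℓ⟩ := exists_isLeast_hslIdeal H f
  refine ⟨⟨ℓ, ?_, ?_, fun x hx ↦ ?_, fun hm ↦ ?_⟩, fun l _ ↦ hjump l⟩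
  · convert hℓ using 3 with l
    exact and_congr_right (hτ l)
  · convert hℓ using 3 with l
    exact and_congr_right fun hl ↦ (hjump l).symm.trans (hτ l hl)
  · rw [IsHSLNumber]
    simpa only [nilKernel_smul_frobeniusAction_eq_iff H f hx] using hℓ
  · have := isLocalRing_quotient_span hm
    have := charP_quotient_span p hm
    intro d y hy
    rw [IsHSLNumber]
    simpa only [nilKernel_frobeniusAction_quotient_eq_iff H hf hm hy] using hℓ
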